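/- Let $p$ be a prime number and let $R$ be a Noetherian local domain of characteristic $p$. Let $R^+$ be the absolute integral closure of $R$, i.e. the integral closure of $R$ in an algebraic closure of its field of fractions, and let $$R_\infty := \{x \in R^+ : x^{p^n} \in R \text{ for some integer } n \ge 0\}$$ be the perfect closure of $R$. Write $\mathrm{pd}$ for projective dimension, $\dim$ for Krull dimension, and $\mathrm{gldim}(A)$ for the supremum of $\mathrm{pd}_A(M)$ over all $A$-modules $M$; a commutative ring is called coherent if each of its finitely generated ideals is finitely presented. Then: (i) For every prime ideal $\mathfrak p$ of $R_\infty$, the $R_\infty$-module $\mathfrak p$ has a bounded resolution by countably generated free modules, i.e. there is an exact sequence $0 \to F_n \to \cdots \to F_0 \to \mathfrak p \to 0$, for some $n$, in which every $F_i$ is a free $R_\infty$-module generated by a countable (possibly finite) set. (ii) If $\dim R < 3$, then $\sup\{\mathrm{pd}_{R_\infty}(R_\infty/\mathfrak p) : \mathfrak p \in \mathrm{Spec}(R_\infty)\} < \infty$. (iii) If $R_\infty$ is coherent, then $\mathrm{gldim}(R_\infty) \le \dim R + 1$. Moreover, $R_\infty$ is coherent whenever $R$ is regular. (iv) If $R$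 is regular and $\dim R = 1$, then $\mathrm{gldim}(R_\infty) = 2$. -/

import Mathlib

universe u

noncomputable section

/-- The absolute integral closure `R⁺` of a domain `R`: the integral closure of `R` in an algebraic
closure of its field of fractions. -/
abbrev AbsIntegralClosure (R : Type u) [CommRing R] [IsDomain R] :
    Subalgebra R (AlgebraicClosure (FractionRing R)) :=
  integralClosure R (AlgebraicClosure (FractionRing R))

/-- `R⁺` contains `R` and so has the same characteristic. -/
theorem absIntegralClosure_charP (R : Type u) [CommRing R] [IsDomain R] (p : ℕ) [CharP R p] :
    CharP (AbsIntegralClosure R) p := by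
  refine charP_of_injective_algebraMap (R := R) ?_ p
  intro a b h
  have h2 : algebraMap R (AlgebraicClosure (FractionRing R)) a =
      algebraMap R (AlgebraicClosure (FractionRing R)) b := congrArg Subtype.val h
  rw [IsScalarTower.algebraMap_apply R (FractionRing R) (AlgebraicClosure (FractionRing R)),
    IsScalarTower.algebraMap_apply R (FractionRing R) (AlgebraicClosure (FractionRing R))] at h2
  exact IsFractionRing.injective R (FractionRing R) ((algebraMap (FractionRing R) _).injective h2)

/-- The perfect closure `R_∞ = {x ∈ R⁺ : x ^ (p ^ n) ∈ R for some n ≥ 0}` of a domain `R` of prime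
characteristic `p`, as an `R`-subalgebra of `R⁺`. -/
def perfClosureSubalgebra (R : Type u) [CommRing R] [IsDomain R] (p : ℕ) [Fact p.Prime] [CharP R p] :
    Subalgebra R (AbsIntegralClosure R) where
  carrier := {x | ∃ n : ℕ, ∃ r : R, algebraMap R (AbsIntegralClosure R) r = x ^ p ^ n}
  mul_mem' := by
    rintro x y ⟨m, r, hr⟩ ⟨n, s, hs⟩
    refine ⟨m + n, r ^ p ^ n * s ^ p ^ m, ?_⟩
    rw [map_mul, map_pow, map_pow, hr, hs, mul_pow, ← pow_mul, ← pow_mul, ← pow_add, ← pow_add,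
      add_comm n m]
  add_mem' := by
    rintro x y ⟨m, r, hr⟩ ⟨n, s, hs⟩
    have := absIntegralClosure_charP R p
    refine ⟨m + n, r ^ p ^ n + s ^ p ^ m, ?_⟩
    rw [map_add, map_pow, map_pow, hr, hs, add_pow_char_pow, ← pow_mul, ← pow_mul, ← pow_add,
      ← pow_add, add_comm n m]
  algebraMap_mem' r := ⟨0, r, by simp⟩

/-- The perfect closure `R_∞` as a type. -/
def PerfClosure (R : Type u) [CommRing R] [IsDomain R] (p : ℕ) [Fact p.Prime] [CharP R p] :
    Type u :=
  perfClosureSubalgebra R p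

instance (R : Type u) [CommRing R] [IsDomain R] (p : ℕ) [Fact p.Prime] [CharP R p] :
    CommRing (PerfClosure R p) :=
  (perfClosureSubalgebra R p).toCommRing

instance (R : Type u) [CommRing R] [IsDomain R] (p : ℕ) [Fact p.Prime] [CharP R p] :
    Algebra R (PerfClosure R p) :=
  (perfClosureSubalgebra R p).algebra

/-- A commutative ring is coherent if each finitely generated ideal is finitely presented. -/
def IsCoherentCommRing (A : Type u) [CommRing A] : Prop :=
  ∀ I : Ideal A, I.FG → Module.FinitePresentation A I

/-- The projective dimension `pd_A M` (it is `⊥` for the zero module). -/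
def projDim (A : Type u) [CommRing A] (M : Type u) [AddCommGroup M] [Module A M] : WithBot ℕ∞ :=
  CategoryTheory.projectiveDimension (ModuleCat.of A M)

/-- The global dimension of `A`: the supremum of the projective dimensions of all `A`-modules. -/
def globalDim (A : Type u) [CommRing A] : WithBot ℕ∞ :=
  ⨆ M : ModuleCat.{u} A, CategoryTheory.projectiveDimension M

/-- The module `M` has a generating set that is countable (possibly finite). -/
def IsCountablyGeneratedModule (A : Type u) [CommRing A] (M : Type u) [AddCommGroup M]
    [Module A M] : Prop :=
  ∃ s : Set M, s.Countable ∧ Submodule.span A s = ⊤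

/-- `M` has a bounded resolution by countably generated free modules: an exact sequence
`0 → F n → ⋯ → F 1 → F 0 → M → 0` with all `F i` free and countably generated. The sequence is
indexed by all of `ℕ`, with `F i = 0` for `i > n`. -/
def HasBoundedCountableFreeResolution (A : Type u) [CommRing A] (M : Type u) [AddCommGroup M]
    [Module A M] : Prop :=
  ∃ (n : ℕ) (F : ℕ → ModuleCat.{u} A) (d : ∀ i, F (i + 1) →ₗ[A] F i) (ε : F 0 →ₗ[A] M),
    (∀ i, Module.Free A (F i) ∧ IsCountablyGeneratedModule A (F i)) ∧
    (∀ i, n < i → Subsingleton (F i)) ∧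
    Function.Surjective ε ∧ Function.Exact (d 0) ε ∧
    ∀ i, Function.Exact (d (i + 1)) (d i)

end

/-! Write `A` for the perfect closure. It is a perfect domain and the increasing union of the
Noetherian rings `R^(1/p^n)`; hence submodules of countably generated `A`-modules are countably
generated, and every prime of `A` is the radical of the extension of a finitely generated ideal of
`R`.

Put `x_k = x^(1/p^k)`. For a radical ideal `J` and `x ≠ 0`, the ideal `J ∩ rad(x)` is the colimit of
`J → J → ⋯` with transition maps `x_(k+1)^(p-1)`, so the telescope sequence gives it projective
dimension at most `pd J + 1`. Since `rad(J + (x)) = J + rad(x)`, Mayer–Vietoris and induction bound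
`pd rad(x_1, …, x_n)` by `2n` (`hasPdLT_radical_span`). This yields (i). For (ii) the number of
generators up to radical must be uniform: when `dim R < 3`, two suffice for each nonmaximal prime
(`exists_finset_radical_span_eq`).

The same roots show that `Tor_(n+1)(A/J, -) = 0` for `J = rad(x_1, …, x_n)`
(`TorVanishing.sup_radical`). The maximal ideal of `A` is the radical of `d = dim R` elements. If
`A` is coherent, the `d`-th syzygy of a finitely presented module can be taken finitely presented,
and is then free, so `pd A/I ≤ d` for finitely generated `I`. An arbitrary ideal is a countable
union of such, which costs one more, and Auslander's theorem concludes. When `R` is regular,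
Frobenius is flat (Kunz), so each `R^(1/p^n) → A` is flat and finitely generated ideals of `A`
inherit finite presentation.

For (iv), if the global dimension were below 2, the maximal ideal of `A` would be projective, hence
finitely generated; it is idempotent, so it would vanish by Nakayama. -/

/-! ### Projective dimension in short exact sequences and direct sums. -/

section ProjectiveDimension

open CategoryTheory

variable {A : Type u} [CommRing A]

/-- The module `M` has projective dimension less than `n`. -/
abbrev HasPdLT (A : Type u) [CommRing A] (M : Type u) [AddCommGroup M] [Module A M] (n : ℕ) : Prop :=
  HasProjectiveDimensionLT (ModuleCat.of A M) n

variable {L M N : Type u} [AddCommGroup L] [Module A L] [AddCommGroup M] [Module A M]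
  [AddCommGroup N] [Module A N]

theorem HasPdLT.mono {m n : ℕ} (h : HasPdLT A M m) (hmn : m ≤ n) : HasPdLT A M n :=
  hasProjectiveDimensionLT_of_ge _ m n hmn

theorem HasPdLT.of_equiv {n : ℕ} (h : HasPdLT A M n) (e : M ≃ₗ[A] N) : HasPdLT A N n :=
  hasProjectiveDimensionLT_of_iso e.toModuleIso n

theorem hasPdLT_one_iff : HasPdLT A M 1 ↔ Module.Projective A M := by
  rw [IsProjective.iff_projective, projective_iff_hasProjectiveDimensionLT_one]

theorem HasPdLT.of_projective [h : Module.Projective A M] {n : ℕ} (hn : 1 ≤ n) : HasPdLT A M n :=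
  (hasPdLT_one_iff.2 h).mono hn

theorem hasPdLT_zero_iff : HasPdLT A M 0 ↔ Subsingleton M := by
  rw [HasPdLT, hasProjectiveDimensionLT_zero_iff_isZero, ModuleCat.isZero_iff_subsingleton]

theorem HasPdLT.of_subsingleton [Subsingleton M] (n : ℕ) : HasPdLT A M n :=
  (hasPdLT_zero_iff.2 ‹_›).mono n.zero_le

section Exact

variable {f : L →ₗ[A] M} {g : M →ₗ[A] N} (hf : Function.Injective f) (hg : Function.Surjective g)
  (hfg : Function.Exact f g)
include hf hg hfg

theorem Function.Exact.shortExact_moduleCat :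
    (ModuleCat.shortComplexOfCompEqZero f g hfg.linearMap_comp_eq_zero).ShortExact :=
  ModuleCat.shortComplex_shortExact _ hfg hf hg

theorem HasPdLT.middle {n : ℕ} (h₁ : HasPdLT A L n) (h₃ : HasPdLT A N n) : HasPdLT A M n :=
  (hfg.shortExact_moduleCat hf hg).hasProjectiveDimensionLT_X₂ n h₁ h₃

theorem HasPdLT.right {n : ℕ} (h₁ : HasPdLT A L n) (h₂ : HasPdLT A M (n + 1)) :
    HasPdLT A N (n + 1) :=
  (hfg.shortExact_moduleCat hf hg).hasProjectiveDimensionLT_X₃ n h₁ h₂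

theorem HasPdLT.left {n : ℕ} (h₂ : HasPdLT A M n) (h₃ : HasPdLT A N (n + 1)) :
    HasPdLT A L n :=
  (hfg.shortExact_moduleCat hf hg).hasProjectiveDimensionLT_X₁ n h₂ h₃

end Exact

theorem HasPdLT.prod {n : ℕ} (h₁ : HasPdLT A M n) (h₂ : HasPdLT A N n) : HasPdLT A (M × N) n :=
  HasPdLT.middle (f := LinearMap.inl A M N) (g := LinearMap.snd A M N) LinearMap.inl_injective
    LinearMap.snd_surjective (.inl_snd) h₁ h₂

theorem HasPdLT.ker {n : ℕ} [Module.Projective A M] (g : M →ₗ[A] N) (hg : Function.Surjective g)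
    (h : HasPdLT A N (n + 2)) : HasPdLT A (LinearMap.ker g) (n + 1) :=
  HasPdLT.left (Submodule.subtype_injective _) hg g.exact_subtype_ker_map
    (.of_projective (by lia)) h

theorem HasPdLT.of_ker {n : ℕ} [Module.Projective A M] (g : M →ₗ[A] N)
    (hg : Function.Surjective g) (h : HasPdLT A (LinearMap.ker g) n) : HasPdLT A N (n + 1) :=
  HasPdLT.right (Submodule.subtype_injective _) hg g.exact_subtype_ker_map
    h (.of_projective (by lia))

/-- Dimension shifting: the direct sum of the canonical free covers has the direct sum of their
kernels as kernel. Zero and projective summands form the base cases. -/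
theorem HasPdLT.dfinsupp {n : ℕ} (X : ℕ → Type u) [∀ i, AddCommGroup (X i)] [∀ i, Module A (X i)]
    (h : ∀ i, HasPdLT A (X i) n) : HasPdLT A (Π₀ i, X i) n := by
  induction n generalizing X with
  | zero =>
    simp only [hasPdLT_zero_iff] at h ⊢
    infer_instance
  | succ n ih =>
    cases n with
    | zero =>
      simp only [zero_add, hasPdLT_one_iff] at h ⊢
      infer_instance
    | succ n =>
      let g (i : ℕ) : (X i →₀ A) →ₗ[A] X i := Finsupp.linearCombination A id
      have hg (i : ℕ) : Function.Surjective (g i) := Finsupp.linearCombination_id_surjective A _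
      have hk := ih (fun i ↦ LinearMap.ker (g i)) fun i ↦ (h i).ker (g i) (hg i)
      refine HasPdLT.right (M := Π₀ i, (X i →₀ A))
        (f := DFinsupp.mapRange.linearMap fun i ↦ (LinearMap.ker (g i)).subtype)
        (g := DFinsupp.mapRange.linearMap g) ?_ ?_ ?_ hk (.of_projective (by lia))
      · exact (DFinsupp.mapRange_injective _ fun i ↦ map_zero _).2
          fun i ↦ Submodule.subtype_injective _
      · exact (DFinsupp.mapRange_surjective _ fun i ↦ map_zero _).2 hg
      · intro x
        constructor
        · intro hx
          classical
          refine ⟨DFinsupp.mk x.support fun i ↦ ⟨x i, ?_⟩, ?_⟩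
          · simpa using congr($hx i)
          · ext1 i
            by_cases hi : i ∈ x.support
            · simp [hi, DFinsupp.mk_apply]
            · have : x i = 0 := by simpa using hi
              simp [this, DFinsupp.mk_apply]
        · rintro ⟨y, rfl⟩
          ext1 i
          simp

end ProjectiveDimension

/-! ### The telescope of a sequence of modules. -/

section Telescope

open CategoryTheory

variable {A : Type u} [CommRing A] {X : ℕ → Type u} [∀ i, AddCommGroup (X i)]
  [∀ i, Module A (X i)] {Y : Type u} [AddCommGroup Y] [Module A Y]

/-- The map `⨁ X i → ⨁ X i` given by `x ↦ x - t x`, whose cokernel is the colimit of the sequence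
`X 0 → X 1 → ⋯`. -/
noncomputable def telescopeMap (t : ∀ i, X i →ₗ[A] X (i + 1)) : (Π₀ i, X i) →ₗ[A] Π₀ i, X i :=
  DFinsupp.lsum ℕ fun i ↦ DFinsupp.lsingle i - DFinsupp.lsingle (i + 1) ∘ₗ t i

variable (t : ∀ i, X i →ₗ[A] X (i + 1)) (c : ∀ i, X i →ₗ[A] Y)

theorem telescopeMap_single (i : ℕ) (x : X i) :
    telescopeMap t (DFinsupp.single i x) =
      DFinsupp.single i x - DFinsupp.single (i + 1) (t i x) := by
  simp [telescopeMap]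

theorem telescopeMap_apply_zero (x : Π₀ i, X i) : telescopeMap t x 0 = x 0 := by
  induction x using DFinsupp.induction with
  | h0 => simp
  | ha i b f _ _ ih =>
    rw [map_add, DFinsupp.add_apply, ih, telescopeMap_single]
    simp

theorem telescopeMap_apply_succ (x : Π₀ i, X i) (j : ℕ) :
    telescopeMap t x (j + 1) = x (j + 1) - t j (x j) := by
  induction x using DFinsupp.induction with
  | h0 => simp
  | ha i b f _ _ ih =>
    rw [map_add, DFinsupp.add_apply, ih, telescopeMap_single]
    obtain rfl | h := eq_or_ne i j
    · simp; abel
    · simp [DFinsupp.single_eq_of_ne h.symm, DFinsupp.single_eq_of_ne (show j + 1 ≠ i + 1 by lia)]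
      abel

theorem telescopeMap_injective : Function.Injective (telescopeMap t) := by
  rw [injective_iff_map_eq_zero]
  intro x hx
  ext1 j
  induction j with
  | zero => rw [← telescopeMap_apply_zero t, hx]
  | succ j ih =>
    have := telescopeMap_apply_succ t x j
    rw [hx, ih] at this
    simpa using this.symm

/-- The image of `x : X i` in `X (i + k)`. -/
def telescopePush (i : ℕ) (x : X i) : (k : ℕ) → X (i + k)
  | 0 => x
  | k + 1 => t (i + k) (telescopePush i x k)

theorem single_sub_single_telescopePush_mem (i : ℕ) (x : X i) (k : ℕ) :
    DFinsupp.single i x - DFinsupp.single (i + k) (telescopePush t i x k) ∈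
      LinearMap.range (telescopeMap t) := by
  induction k with
  | zero => simp [telescopePush]
  | succ k ih =>
    have := add_mem ih
      ⟨DFinsupp.single (i + k) (telescopePush t i x k), telescopeMap_single t _ _⟩
    simpa using! this

/-- Modulo the range, an element may be pushed forward, so its finitely many components can be
collected in one degree. -/
theorem exists_single_sub_mem_range_telescopeMap (x : Π₀ i, X i) :
    ∃ j, ∃ y : X j, x - DFinsupp.single j y ∈ LinearMap.range (telescopeMap t) := by
  have push (i j : ℕ) (hij : i ≤ j) (y : X i) : ∃ z : X j,
      DFinsupp.single i y - DFinsupp.single j z ∈ LinearMap.range (telescopeMap t) := by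
    obtain ⟨k, rfl⟩ := Nat.exists_eq_add_of_le hij
    exact ⟨_, single_sub_single_telescopePush_mem t i y k⟩
  induction x using DFinsupp.induction with
  | h0 => exact ⟨0, 0, by simp⟩
  | ha i b f _ _ ih =>
    obtain ⟨j, y, hy⟩ := ih
    obtain ⟨z, hz⟩ := push i (max i j) (le_max_left _ _) b
    obtain ⟨w, hw⟩ := push j (max i j) (le_max_right _ _) y
    refine ⟨_, z + w, ?_⟩
    have := add_mem (add_mem hz hw) hy
    rw [DFinsupp.single_add]
    convert this using 1
    abel

variable {t c} (hc : ∀ i x, c (i + 1) (t i x) = c i x)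
include hc

theorem telescope_exact (hz : ∀ i x, c i x = 0 → ∃ k, telescopePush t i x k = 0) :
    Function.Exact (telescopeMap t) (DFinsupp.lsum ℕ c) := by
  have hle : ∀ x, DFinsupp.lsum ℕ c (telescopeMap t x) = 0 := by
    intro x
    induction x using DFinsupp.induction with
    | h0 => simp
    | ha i b f _ _ ih =>
      rw [map_add, map_add, ih, telescopeMap_single]
      simp [hc]
  refine fun x ↦ ⟨fun hx ↦ ?_, ?_⟩
  · obtain ⟨j, y, z, hz'⟩ := exists_single_sub_mem_range_telescopeMap t x
    have hy : c j y = 0 := by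
      have := hle z
      rw [hz', map_sub, hx] at this
      simpa using this
    obtain ⟨k, hk⟩ := hz j y hy
    have := single_sub_single_telescopePush_mem t j y k
    rw [hk, DFinsupp.single_zero, sub_zero] at this
    simpa using! add_mem (show x - _ ∈ LinearMap.range (telescopeMap t) from ⟨z, hz'⟩) this
  · rintro ⟨y, rfl⟩
    exact hle y

omit hc in
theorem telescope_surjective (hs : ∀ y, ∃ i x, c i x = y) :
    Function.Surjective (DFinsupp.lsum ℕ c) := by
  intro y
  obtain ⟨i, x, rfl⟩ := hs y
  exact ⟨DFinsupp.single i x, by simp⟩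

/-- The hypotheses say that `Y` is the colimit of the `X i`; the bound comes from the exact sequence
`0 → ⨁ X i → ⨁ X i → Y → 0`. -/
theorem HasPdLT.of_telescope (hs : ∀ y, ∃ i x, c i x = y)
    (hz : ∀ i x, c i x = 0 → ∃ k, telescopePush t i x k = 0) {n : ℕ}
    (h : ∀ i, HasPdLT A (X i) n) : HasPdLT A Y (n + 1) :=
  HasPdLT.right (telescopeMap_injective t) (telescope_surjective hs) (telescope_exact hc hz)
    (.dfinsupp X h) ((HasPdLT.dfinsupp X h).mono n.le_succ)

end Telescope

/-! ### Auslander's theorem on global dimension. -/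

section Auslander

open CategoryTheory

open Abelian

variable {A : Type u} [CommRing A]

/-- The obstruction to extending a map `I → N` to `A` lies in `Ext¹(A ⧸ I, N)`. -/
theorem baer_of_ext_eq_zero (N : ModuleCat.{u} A)
    (h : ∀ I : Ideal A, Subsingleton (Ext (ModuleCat.of A (A ⧸ I)) N 1)) : Module.Baer A N := by
  intro I g
  have hI : Function.Exact (I.subtype : I →ₗ[A] A) I.mkQ := LinearMap.exact_subtype_mkQ I
  have hS := hI.shortExact_moduleCat (Submodule.subtype_injective _) I.mkQ_surjective
  obtain ⟨x₂, hx₂⟩ := Ext.contravariant_sequence_exact₁ hS N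
    (Ext.mk₀ (ModuleCat.ofHom g)) rfl ((h I).elim _ _)
  obtain ⟨g', rfl⟩ := (Ext.mk₀_bijective _ _).2 x₂
  rw [Ext.mk₀_comp_mk₀, (Ext.mk₀_bijective _ _).1.eq_iff] at hx₂
  exact ⟨g'.hom, fun x hx ↦ congr($(hx₂).hom ⟨x, hx⟩)⟩

theorem hasInjectiveDimensionLT_of_ext_quotient (n : ℕ) (N : ModuleCat.{u} A)
    (h : ∀ I : Ideal A, Subsingleton (Ext (ModuleCat.of A (A ⧸ I)) N (n + 1))) :
    HasInjectiveDimensionLT N (n + 1) := by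
  induction n generalizing N with
  | zero =>
    rw [← injective_iff_hasInjectiveDimensionLT_one]
    exact (Module.injective_iff_injective_object A N).1
      (Module.Baer.iff_injective.1 (baer_of_ext_eq_zero N h))
  | succ n ih =>
    -- Embed `N` in an injective module; the cokernel satisfies the hypothesis one degree lower.
    obtain ⟨p⟩ := EnoughInjectives.presentation N
    have hS : (ShortComplex.mk _ _ (Limits.cokernel.condition p.f)).ShortExact :=
      { exact := ShortComplex.exact_cokernel p.f }
    refine (hS.hasInjectiveDimensionLT_X₃_iff n p.injective).1 (ih _ fun I ↦ ⟨fun a b ↦ ?_⟩)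
    rw [← sub_eq_zero]
    obtain ⟨x₂, hx₂⟩ := Ext.covariant_sequence_exact₃ _ hS (a - b) rfl ((h I).elim _ _)
    rw [← hx₂, Ext.eq_zero_of_injective x₂, Ext.zero_comp]

/-- Auslander's theorem: projective dimensions of modules are bounded by those of cyclic ones. -/
theorem HasPdLT.of_forall_quotient {n : ℕ} (h : ∀ I : Ideal A, HasPdLT A (A ⧸ I) (n + 1))
    (M : ModuleCat.{u} A) : HasProjectiveDimensionLT M (n + 1) := by
  rw [hasProjectiveDimensionLT_iff]
  intro i hi Y e
  have := hasInjectiveDimensionLT_of_ext_quotient n Y fun I ↦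
    HasProjectiveDimensionLT.subsingleton _ (n + 1) _ le_rfl _
  exact e.eq_zero_of_hasInjectiveDimensionLT (n + 1) hi

theorem globalDim_le_of_forall_quotient {n : ℕ} (h : ∀ I : Ideal A, HasPdLT A (A ⧸ I) (n + 1)) :
    globalDim A ≤ n :=
  iSup_le fun M ↦ (projectiveDimension_le_iff M n).2 (HasPdLT.of_forall_quotient h M)

end Auslander

/-! ### Resolutions by countably generated free modules. -/

section CountableResolution

variable {A : Type u} [CommRing A] {K L M N : Type u} [AddCommGroup K] [Module A K]
  [AddCommGroup L] [Module A L] [AddCommGroup M] [Module A M] [AddCommGroup N] [Module A N]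

theorem IsCountablyGeneratedModule.of_countable_range {ι : Type*} [Countable ι] (v : ι → M)
    (hv : Submodule.span A (Set.range v) = ⊤) : IsCountablyGeneratedModule A M :=
  ⟨Set.range v, Set.countable_range v, hv⟩

theorem IsCountablyGeneratedModule.exists_nat (h : IsCountablyGeneratedModule A M) :
    ∃ v : ℕ → M, Submodule.span A (Set.range v) = ⊤ := by
  obtain ⟨s, hs, hs'⟩ := h
  obtain rfl | hne := s.eq_empty_or_nonempty
  · exact ⟨fun _ ↦ 0, by rw [← hs']; simp⟩
  · obtain ⟨v, rfl⟩ := hs.exists_eq_range hne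
    exact ⟨v, hs'⟩

theorem IsCountablyGeneratedModule.exists_surjective (h : IsCountablyGeneratedModule A M) :
    ∃ g : (ℕ →₀ A) →ₗ[A] M, Function.Surjective g := by
  obtain ⟨v, hv⟩ := h.exists_nat
  exact ⟨Finsupp.linearCombination A v, by
    rw [← LinearMap.range_eq_top, Finsupp.range_linearCombination, hv]⟩

theorem isCountablyGeneratedModule_finsupp (ι : Type) [Countable ι] :
    IsCountablyGeneratedModule A (ι →₀ A) :=
  .of_countable_range (fun i ↦ Finsupp.single i (1 : A)) (by
    simpa using (Finsupp.basisSingleOne (R := A) (ι := ι)).span_eq)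

theorem IsCountablyGeneratedModule.of_surjective (h : IsCountablyGeneratedModule A M)
    (f : M →ₗ[A] N) (hf : Function.Surjective f) : IsCountablyGeneratedModule A N := by
  obtain ⟨s, hs, hs'⟩ := h
  exact ⟨f '' s, hs.image f, by
    rw [Submodule.span_image, hs', Submodule.map_top, LinearMap.range_eq_top.2 hf]⟩

theorem HasBoundedCountableFreeResolution.of_subsingleton [Subsingleton M] :
    HasBoundedCountableFreeResolution A M := by
  refine ⟨0, fun _ ↦ ModuleCat.of A PUnit, fun _ ↦ 0, 0,
    fun _ ↦ ⟨.of_subsingleton A _, ∅, Set.countable_empty, Subsingleton.elim _ _⟩,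
    fun _ _ ↦ inferInstanceAs (Subsingleton PUnit), fun _ ↦ ⟨0, Subsingleton.elim _ _⟩, ?_, ?_⟩
  · exact fun x ↦ ⟨fun _ ↦ ⟨0, rfl⟩, fun _ ↦ rfl⟩
  · exact fun _ x ↦ ⟨fun _ ↦ ⟨0, rfl⟩, fun _ ↦ rfl⟩

/-- The sequence of modules `L, F 0, F 1, …`. -/
def consModules (L : ModuleCat.{u} A) (F : ℕ → ModuleCat.{u} A) : ℕ → ModuleCat.{u} A
  | 0 => L
  | i + 1 => F i

/-- The sequence of maps obtained by putting `e : F 0 → L` in front of the maps `d`. -/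
def consMaps (L : ModuleCat.{u} A) (F : ℕ → ModuleCat.{u} A) (e : F 0 →ₗ[A] L)
    (d : ∀ i, F (i + 1) →ₗ[A] F i) : ∀ i, consModules L F (i + 1) →ₗ[A] consModules L F i
  | 0 => e
  | i + 1 => d i

theorem HasBoundedCountableFreeResolution.of_exact {f : K →ₗ[A] L} {g : L →ₗ[A] M}
    (hf : Function.Injective f) (hg : Function.Surjective g) (hfg : Function.Exact f g)
    [Module.Free A L] (hL : IsCountablyGeneratedModule A L)
    (hK : HasBoundedCountableFreeResolution A K) : HasBoundedCountableFreeResolution A M := by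
  obtain ⟨n, F, d, ε, hF, hn, hε, hdε, hd⟩ := hK
  refine ⟨n + 1, consModules (ModuleCat.of A L) F,
    consMaps (ModuleCat.of A L) F (f ∘ₗ ε) d, g, ?_, ?_, hg, ?_, ?_⟩
  · rintro (_ | i)
    exacts [⟨‹_›, hL⟩, hF i]
  · rintro (_ | i) hi
    exacts [by lia, hn i (by lia)]
  · exact (hε.comp_exact_iff_exact (f := f)).2 hfg
  · rintro (_ | i)
    exacts [hf.comp_exact_iff_exact.2 hdε, hd i]

theorem HasBoundedCountableFreeResolution.of_free [Module.Free A M]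
    (hM : IsCountablyGeneratedModule A M) : HasBoundedCountableFreeResolution A M :=
  .of_exact (f := (0 : PUnit.{u + 1} →ₗ[A] M)) (g := LinearMap.id)
    (Function.injective_of_subsingleton _) Function.surjective_id
    (LinearMap.exact_zero_iff_injective _ _ |>.2 Function.injective_id) hM .of_subsingleton

/-- A countably generated projective module is the cokernel of an injective map between countably
generated free modules: the telescope of an idempotent. -/
theorem HasBoundedCountableFreeResolution.of_projective [Module.Projective A M]
    (hM : IsCountablyGeneratedModule A M) : HasBoundedCountableFreeResolution A M := by
  classical
  obtain ⟨g, hg⟩ := hM.exists_surjective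
  obtain ⟨s, hs⟩ := Module.projective_lifting_property g LinearMap.id hg
  let t (i : ℕ) : (ℕ →₀ A) →ₗ[A] (ℕ →₀ A) := s ∘ₗ g
  have hgs (y : M) : g (s y) = y := congr($hs y)
  have hc (i : ℕ) (x : ℕ →₀ A) : g (t i x) = g x := hgs _
  have hfree : IsCountablyGeneratedModule A (Π₀ _ : ℕ, (ℕ →₀ A)) :=
    (isCountablyGeneratedModule_finsupp (A := A) (ℕ × ℕ)).of_surjective
      ((finsuppLequivDFinsupp A).toLinearMap ∘ₗ (Finsupp.curryLinearEquiv A).toLinearMap)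
      ((finsuppLequivDFinsupp A).surjective.comp (Finsupp.curryLinearEquiv A).surjective)
  -- `M` is the colimit of the free module under the idempotent `s ∘ g`; anything killed by `g` dies
  -- after one transition.
  refine .of_exact (telescopeMap_injective t) (telescope_surjective (c := fun _ ↦ g)
    fun y ↦ ⟨0, hg y⟩) (telescope_exact hc fun i x hx ↦ ⟨1, ?_⟩) hfree (.of_free hfree)
  simp [telescopePush, t, hx]

/-- All submodules of countably generated modules are countably generated. -/
def IsCountablyNoetherian (A : Type u) [CommRing A] : Prop :=
  ∀ (M : Type u) [AddCommGroup M] [Module A M], IsCountablyGeneratedModule A M →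
    ∀ N : Submodule A M, IsCountablyGeneratedModule A N

theorem IsCountablyNoetherian.hasBoundedCountableFreeResolution (hA : IsCountablyNoetherian A)
    {n : ℕ} (hM : IsCountablyGeneratedModule A M) (h : HasPdLT A M (n + 1)) :
    HasBoundedCountableFreeResolution A M := by
  induction n generalizing M with
  | zero =>
    rw [zero_add, hasPdLT_one_iff] at h
    exact .of_projective hM
  | succ n ih =>
    obtain ⟨g, hg⟩ := hM.exists_surjective
    exact .of_exact (Submodule.subtype_injective _) hg g.exact_subtype_ker_map
      (isCountablyGeneratedModule_finsupp ℕ)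
      (ih (hA _ (isCountablyGeneratedModule_finsupp ℕ) _) (h.ker g hg))

/-- `M` is the union of the `V k`, spanned over the Noetherian subring `S k` by the first `k`
generators. Each `V k ∩ N` is finitely generated over `S k`, and these countably many finite sets
generate `N`. -/
theorem IsCountablyNoetherian.of_iUnion_range {R : Type*} [CommRing R] [IsNoetherianRing R]
    (φ : ℕ → R →+* A) (hmono : Monotone fun k ↦ (φ k).range) (hφ : ∀ a, ∃ k, a ∈ (φ k).range) :
    IsCountablyNoetherian A := by
  intro M _ _ hM N
  obtain ⟨v, hv⟩ := hM.exists_nat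
  let S (k : ℕ) : Subring A := (φ k).range
  let V (k : ℕ) : Submodule (S k) M := Submodule.span (S k) (v '' Set.Iio k)
  have hVfg (k : ℕ) : (V k).FG := Submodule.fg_span ((Set.finite_Iio k).image v)
  have hVmono (k l : ℕ) (hkl : k ≤ l) {x : M} (hx : x ∈ V k) : x ∈ V l := by
    induction hx using Submodule.span_induction with
    | mem x hx => exact Submodule.subset_span (Set.image_mono (Set.Iio_subset_Iio hkl) hx)
    | zero => exact zero_mem _
    | add x y _ _ hx hy => exact add_mem hx hy
    | smul a x _ hx => exact (V l).smul_mem (⟨a.1, hmono hkl a.2⟩ : S l) hx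
  have hV (x : M) : ∃ k, x ∈ V k := by
    have hx : x ∈ Submodule.span A (Set.range v) := hv ▸ Submodule.mem_top
    induction hx using Submodule.span_induction with
    | mem x hx =>
      obtain ⟨i, rfl⟩ := hx
      exact ⟨i + 1, Submodule.subset_span ⟨i, by simp, rfl⟩⟩
    | zero => exact ⟨0, zero_mem _⟩
    | add x y _ _ hx hy =>
      obtain ⟨k, hk⟩ := hx
      obtain ⟨l, hl⟩ := hy
      exact ⟨max k l, add_mem (hVmono _ _ (le_max_left _ _) hk) (hVmono _ _ (le_max_right _ _) hl)⟩
    | smul a x _ hx =>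
      obtain ⟨k, hk⟩ := hx
      obtain ⟨l, hl⟩ := hφ a
      exact ⟨max k l, (V _).smul_mem (⟨a, hmono (le_max_right k l) hl⟩ : S (max k l))
        (hVmono _ _ (le_max_left _ _) hk)⟩
  have hfg (k : ℕ) : (V k ⊓ N.restrictScalars (S k)).FG := by
    have : IsNoetherianRing (S k) := isNoetherianRing_range (φ k)
    exact Submodule.FG.of_le (hVfg k) inf_le_left
  choose s hs using hfg
  have hsN (k : ℕ) (x : M) (hx : x ∈ s k) : x ∈ N :=
    (show x ∈ V k ⊓ N.restrictScalars (S k) from hs k ▸ Submodule.subset_span hx).2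
  refine ⟨⋃ k, Subtype.val ⁻¹' (s k : Set M), Set.countable_iUnion fun k ↦
    ((s k).finite_toSet.preimage Subtype.val_injective.injOn).countable, ?_⟩
  rw [eq_top_iff]
  rintro ⟨x, hx⟩ -
  obtain ⟨k, hk⟩ := hV x
  have hx' : x ∈ Submodule.span (S k) (s k : Set M) := hs k ▸ ⟨hk, hx⟩
  have : x ∈ (Submodule.span A (⋃ k, Subtype.val ⁻¹' (s k : Set M) : Set N)).map N.subtype := by
    rw [Submodule.map_span]
    refine Submodule.span_subset_span (S k) A _ (Submodule.span_mono ?_ hx')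
    intro y hy
    exact ⟨⟨y, hsN k y hy⟩, Set.mem_iUnion.2 ⟨k, hy⟩, rfl⟩
  obtain ⟨y, hy, rfl⟩ := this
  exact hy

end CountableResolution

/-! ### Radical ideals in a perfect ring. -/

section PerfectRing

variable {A : Type u} [CommRing A] (p : ℕ) [Fact p.Prime] [CharP A p] [PerfectRing A p]

/-- The `p ^ k`-th root of an element of a perfect ring of characteristic `p`. -/
noncomputable def frobRoot (k : ℕ) : A ≃+* A := (iterateFrobeniusEquiv A p k).symm

theorem frobRoot_pow (k : ℕ) (x : A) : frobRoot p k x ^ p ^ k = x :=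
  (iterateFrobeniusEquiv A p k).apply_symm_apply x

theorem frobRoot_pow_self (k : ℕ) (x : A) : frobRoot p k (x ^ p ^ k) = x :=
  (iterateFrobeniusEquiv A p k).symm_apply_apply x

theorem frobRoot_eq_of_pow_eq {k : ℕ} {x y : A} (h : y ^ p ^ k = x) : frobRoot p k x = y := by
  rw [← h, frobRoot_pow_self]

theorem frobRoot_succ_pow (k : ℕ) (x : A) : frobRoot p (k + 1) x ^ p = frobRoot p k x :=
  (frobRoot_eq_of_pow_eq p (by rw [← pow_mul, ← pow_succ', frobRoot_pow])).symm

theorem frobRoot_succ_mul (k : ℕ) (x : A) :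
    frobRoot p (k + 1) x * frobRoot p (k + 1) x ^ (p - 1) = frobRoot p k x := by
  rw [← pow_succ', Nat.sub_add_cancel (Fact.out : p.Prime).one_le, frobRoot_succ_pow]

theorem frobRoot_mem_radical {J : Ideal A} {x : A} (hx : x ∈ J) (k : ℕ) :
    frobRoot p k x ∈ J.radical :=
  ⟨p ^ k, by rwa [frobRoot_pow]⟩

variable {J : Ideal A} (hJ : J.IsRadical)
include p hJ

theorem Ideal.IsRadical.frobRoot_mem {x : A} (hx : x ∈ J) (k : ℕ) : frobRoot p k x ∈ J :=
  hJ (frobRoot_mem_radical p hx k)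

/-- The condition does not depend on the root: it gives `x * y ∈ J`, and then the `p ^ l`-th power
of the new product, `x * y ^ p ^ l`, lies in `J`. -/
theorem Ideal.IsRadical.frobRoot_mul_mem {x y : A} {k : ℕ} (h : frobRoot p k x * y ∈ J) (l : ℕ) :
    frobRoot p l x * y ∈ J := by
  have hxy : x * y ∈ J := by
    have := J.mul_mem_left (frobRoot p k x ^ (p ^ k - 1)) h
    rwa [← mul_assoc, pow_sub_one_mul (NeZero.ne _), frobRoot_pow] at this
  refine hJ ⟨p ^ l, ?_⟩
  rw [mul_pow, frobRoot_pow, ← pow_sub_one_mul (NeZero.ne (p ^ l)) y, ← mul_assoc, mul_right_comm]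
  exact J.mul_mem_right _ hxy

theorem Ideal.IsRadical.frobRoot_pow_mul_mem {x y : A} {k : ℕ} (h : frobRoot p k x * y ∈ J) :
    frobRoot p (k + 1) x ^ (p - 1) * y ∈ J := by
  have hp : p - 1 ≠ 0 := Nat.sub_ne_zero_of_lt (Fact.out : p.Prime).one_lt
  rw [← pow_sub_one_mul hp, mul_assoc]
  exact J.mul_mem_left _ (hJ.frobRoot_mul_mem p h _)

/-- Some `z ^ p ^ n` has the form `j + x * c`; extract `p ^ n`-th roots, which are additive and
preserve the radical ideal `J`. -/
theorem Ideal.IsRadical.exists_of_mem_radical_sup {x z : A}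
    (hz : z ∈ (J ⊔ Ideal.span {x}).radical) : ∃ k, ∃ j ∈ J, ∃ c, z = j + frobRoot p k x * c := by
  obtain ⟨n, hn⟩ := hz
  have hz' : z ^ p ^ n ∈ J ⊔ Ideal.span {x} :=
    Ideal.pow_mem_of_pow_mem _ hn (Nat.lt_pow_self (Fact.out : p.Prime).one_lt).le
  obtain ⟨j, hj, w, hw, h⟩ := Submodule.mem_sup.1 hz'
  obtain ⟨c, rfl⟩ := Ideal.mem_span_singleton.1 hw
  exact ⟨n, frobRoot p n j, hJ.frobRoot_mem p hj n, frobRoot p n c, by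
    rw [← map_mul, ← map_add, h, frobRoot_pow_self]⟩

theorem Ideal.IsRadical.radical_sup (x : A) :
    (J ⊔ Ideal.span {x}).radical = J ⊔ (Ideal.span {x}).radical := by
  refine le_antisymm (fun z hz ↦ ?_) (sup_le (le_sup_left.trans Ideal.le_radical)
    (Ideal.radical_mono le_sup_right))
  obtain ⟨k, j, hj, c, rfl⟩ := hJ.exists_of_mem_radical_sup p hz
  exact add_mem (Ideal.mem_sup_left hj) (Ideal.mem_sup_right (Ideal.mul_mem_right _ _
    (frobRoot_mem_radical p (Ideal.mem_span_singleton_self x) k)))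

omit hJ in
theorem exists_of_mem_radical_span_singleton [IsReduced A] {x z : A}
    (hz : z ∈ (Ideal.span {x}).radical) : ∃ k c, z = frobRoot p k x * c := by
  have hbot : (⊥ : Ideal A).IsRadical := Ideal.isRadical_bot
  obtain ⟨k, j, rfl, c, rfl⟩ := hbot.exists_of_mem_radical_sup (x := x) p (by simpa using hz)
  exact ⟨k, c, by simp⟩

omit hJ in
theorem radical_span_insert (x : A) (s : Set A) :
    (Ideal.span (insert x s)).radical = (Ideal.span s).radical ⊔ (Ideal.span {x}).radical := by
  rw [← (Ideal.radical_isRadical (Ideal.span s)).radical_sup p, Ideal.span_insert, sup_comm,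
    Ideal.radical_sup, Ideal.radical_sup (Ideal.radical _) (Ideal.span {x}), Ideal.radical_idem]

/-- The intersection is the union of the submodules `x_i J`, where `x_i` is the `p ^ i`-th root of
`x`. Each is a copy of `J`, and inclusion becomes multiplication by `x_(i+1) ^ (p - 1)`. -/
theorem HasPdLT.inf_radical_span_singleton [IsDomain A] {x : A} (hx : x ≠ 0) {n : ℕ}
    (h : HasPdLT A J n) :
    HasPdLT A ((J ⊓ (Ideal.span {x}).radical : Ideal A)) (n + 1) := by
  have hmem (i : ℕ) (y : J) : frobRoot p i x * y ∈ J ⊓ (Ideal.span {x}).radical :=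
    ⟨J.mul_mem_left _ y.2, Ideal.mul_mem_right _ _
      (frobRoot_mem_radical p (Ideal.mem_span_singleton_self x) i)⟩
  let t (i : ℕ) : J →ₗ[A] J := LinearMap.lsmul A J (frobRoot p (i + 1) x ^ (p - 1))
  let c (i : ℕ) : J →ₗ[A] (J ⊓ (Ideal.span {x}).radical : Ideal A) :=
    (LinearMap.lsmul A A (frobRoot p i x) ∘ₗ J.subtype).codRestrict _ (hmem i)
  have hcv (i : ℕ) (y : J) : (c i y : A) = frobRoot p i x * y := rfl
  refine HasPdLT.of_telescope (X := fun _ ↦ J) (t := t) (c := c) ?_ ?_ ?_ fun _ ↦ h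
  · intro i y
    ext
    rw [hcv, hcv, ← frobRoot_succ_mul p i, mul_assoc]
    rfl
  · rintro ⟨z, hzJ, hz⟩
    obtain ⟨k, d, rfl⟩ := exists_of_mem_radical_span_singleton p hz
    -- The cofactor `d` need not lie in `J`, but it does after multiplication by `x_(k+1) ^ (p -
    -- 1)`, hence the shift to `k + 1`.
    refine ⟨k + 1, ⟨_, hJ.frobRoot_pow_mul_mem p hzJ⟩, ?_⟩
    ext
    rw [hcv, ← mul_assoc, frobRoot_succ_mul]
  · intro i y hy
    have := congrArg Subtype.val hy
    rw [hcv] at this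
    exact ⟨0, by simpa [hx, telescopePush] using this⟩

end PerfectRing

/-! ### Projective dimension of radicals of finitely generated ideals. -/

section Pd

variable {A : Type u} [CommRing A]

/-- Mayer–Vietoris: `0 → I ∩ J → I × J → I + J → 0`. -/
theorem HasPdLT.sup (I J : Ideal A) {n : ℕ} (hI : HasPdLT A I (n + 1)) (hJ : HasPdLT A J (n + 1))
    (hIJ : HasPdLT A (I ⊓ J : Ideal A) n) : HasPdLT A (I ⊔ J : Ideal A) (n + 1) := by
  refine HasPdLT.right
    (f := (Submodule.inclusion inf_le_left).prod (-Submodule.inclusion inf_le_right))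
    (g := (Submodule.inclusion le_sup_left).coprod (Submodule.inclusion le_sup_right))
    ?_ ?_ ?_ hIJ (hI.prod hJ)
  · intro a b hab
    ext
    exact congrArg (fun x : I × J ↦ (x.1 : A)) hab
  · rintro ⟨z, hz⟩
    obtain ⟨a, ha, b, hb, rfl⟩ := Submodule.mem_sup.1 hz
    exact ⟨(⟨a, ha⟩, ⟨b, hb⟩), rfl⟩
  · rintro ⟨⟨a, ha⟩, ⟨b, hb⟩⟩
    constructor
    · intro h
      have h' : a + b = 0 := congrArg Subtype.val h
      obtain rfl := eq_neg_of_add_eq_zero_right h'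
      exact ⟨⟨a, ha, by simpa using hb⟩, rfl⟩
    · rintro ⟨⟨c, hc⟩, hc'⟩
      rw [← hc']
      ext
      simp

theorem HasPdLT.quotient (I : Ideal A) {n : ℕ} (h : HasPdLT A I n) : HasPdLT A (A ⧸ I) (n + 1) :=
  HasPdLT.right (Submodule.subtype_injective I) I.mkQ_surjective (LinearMap.exact_subtype_mkQ I) h
    (.of_projective (by lia))

variable (p : ℕ) [Fact p.Prime] [CharP A p] [PerfectRing A p] [IsDomain A]
include p

/-- Each new generator raises the bound by two: one for the telescope of the intersection, one for
Mayer–Vietoris. -/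
theorem hasPdLT_radical_span (s : Finset A) :
    HasPdLT A (Ideal.span (s : Set A)).radical (2 * s.card + 1) := by
  classical
  induction s using Finset.induction_on with
  | empty =>
    have : (Ideal.span ((∅ : Finset A) : Set A)).radical = ⊥ := by
      rw [Finset.coe_empty, Ideal.span_empty]
      exact (Ideal.isRadical_bot : (⊥ : Ideal A).IsRadical).radical
    rw [this]
    exact .of_subsingleton _
  | insert x s hx ih =>
    obtain rfl | hx0 := eq_or_ne x 0
    · rw [Finset.coe_insert, Ideal.span_insert_zero]
      exact ih.mono (by grind)
    have hJ := Ideal.radical_isRadical (Ideal.span (s : Set A))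
    have htop : HasPdLT A (⊤ : Ideal A) 1 :=
      (HasPdLT.of_projective le_rfl : HasPdLT A A 1).of_equiv Submodule.topEquiv.symm
    have hI := HasPdLT.inf_radical_span_singleton p (J := ⊤)
      (fun _ _ ↦ (Submodule.mem_top : _ ∈ (⊤ : Ideal A))) hx0 htop
    rw [top_inf_eq] at hI
    rw [Finset.coe_insert, radical_span_insert p, Finset.card_insert_of_notMem hx]
    exact .sup _ _ (ih.mono (by lia)) (hI.mono (by lia))
      ((ih.inf_radical_span_singleton p hJ hx0).mono (by lia))

end Pd

/-! ### Global dimension of coherent perfect local rings. -/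

section Coherent

variable {A : Type u} [CommRing A]

/-- Project to the first coordinate: the image is a finitely generated ideal, and the kernel embeds
in a free module of smaller rank. -/
theorem IsCoherentCommRing.finitePresentation_of_injective (hA : IsCoherentCommRing A) (n : ℕ)
    {M : Type u} [AddCommGroup M] [Module A M] [Module.Finite A M] (ι : M →ₗ[A] (Fin n → A))
    (hι : Function.Injective ι) : Module.FinitePresentation A M := by
  induction n generalizing M with
  | zero =>
    have := hι.subsingleton
    infer_instance
  | succ n ih =>
    let l : M →ₗ[A] A := LinearMap.proj 0 ∘ₗ ι
    have : Module.FinitePresentation A (LinearMap.range l) :=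
      hA _ (Module.Finite.fg_top.map l |> (LinearMap.range_eq_map l ▸ ·))
    have hfg : (LinearMap.ker l.rangeRestrict).FG :=
      Module.FinitePresentation.fg_ker _ l.surjective_rangeRestrict
    have : Module.Finite A (LinearMap.ker l.rangeRestrict) := Module.Finite.iff_fg.2 hfg
    let τ : (Fin (n + 1) → A) →ₗ[A] (Fin n → A) := LinearMap.funLeft A A Fin.succ
    have := ih (M := LinearMap.ker l.rangeRestrict) (τ ∘ₗ ι ∘ₗ Submodule.subtype _) (by
      rw [injective_iff_map_eq_zero]
      rintro ⟨x, hx⟩ h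
      have hx0 : ι x 0 = 0 := congrArg Subtype.val hx
      have h' : ι x = 0 := by
        funext i
        refine Fin.cases hx0 (fun j ↦ congrFun h j) i
      exact Subtype.ext (hι (h'.trans (map_zero ι).symm)))
    exact Module.finitePresentation_of_ker _ l.surjective_rangeRestrict

theorem IsCoherentCommRing.finitePresentation_ker (hA : IsCoherentCommRing A) (n : ℕ)
    {M : Type u} [AddCommGroup M] [Module A M] [Module.FinitePresentation A M]
    (f : (Fin n → A) →ₗ[A] M) (hf : Function.Surjective f) :
    Module.FinitePresentation A (LinearMap.ker f) := by
  have : Module.Finite A (LinearMap.ker f) :=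
    Module.Finite.iff_fg.2 (Module.FinitePresentation.fg_ker f hf)
  exact hA.finitePresentation_of_injective n _ (Submodule.subtype_injective _)

/-- `N` is an `n`-th syzygy with respect to some resolution by free modules. -/
def IsSyzygy : ℕ → (N : Type u) → [AddCommGroup N] → [Module A N] → Prop
  | 0, _, _, _ => True
  | n + 1, N, _, _ => ∃ (F L : Type u) (_ : AddCommGroup F) (_ : Module A F) (_ : AddCommGroup L)
      (_ : Module A L) (ι : N →ₗ[A] F) (g : F →ₗ[A] L), Module.Free A F ∧ Function.Injective ι ∧
      Function.Surjective g ∧ Function.Exact ι g ∧ IsSyzygy n L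

theorem IsSyzygy.of_succ {n : ℕ} {N : Type u} [AddCommGroup N] [Module A N]
    (h : IsSyzygy (A := A) (n + 1) N) : IsSyzygy (A := A) n N := by
  induction n generalizing N with
  | zero => trivial
  | succ n ih =>
    obtain ⟨F, L, _, _, _, _, ι, g, hF, hι, hg, hιg, hL⟩ := h
    exact ⟨F, L, _, _, _, _, ι, g, hF, hι, hg, hιg, ih hL⟩

/-- `Tor₁(A ⧸ J, N) = 0` for all `n`-th syzygies `N`. -/
def TorVanishing (n : ℕ) (J : Ideal A) : Prop :=
  ∀ (F N : Type u) [AddCommGroup F] [Module A F] [AddCommGroup N] [Module A N] [Module.Free A F]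
    (f : F →ₗ[A] N), IsSyzygy (A := A) n N → Function.Surjective f →
      LinearMap.ker f ⊓ J • ⊤ ≤ J • LinearMap.ker f

theorem torVanishing_bot : TorVanishing 0 (⊥ : Ideal A) := by
  intro F N _ _ _ _ _ f _ _
  simp

theorem Module.Basis.mem_ideal_smul_top_iff {ι F : Type*} [AddCommGroup F] [Module A F]
    (b : Module.Basis ι A F) (J : Ideal A) (w : F) :
    w ∈ (J • ⊤ : Submodule A F) ↔ ∀ i, b.repr w i ∈ J := by
  constructor
  · intro hw i
    have := Submodule.mem_map_of_mem (f := b.coord i) hw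
    rw [Submodule.map_smul''] at this
    have : b.coord i w ∈ (J • ⊤ : Submodule A A) := Submodule.smul_mono le_rfl le_top this
    rwa [smul_eq_mul, Ideal.mul_top] at this
  · intro h
    rw [← b.linearCombination_repr w, Finsupp.linearCombination_apply]
    exact Submodule.sum_mem _ fun i _ ↦ Submodule.smul_mem_smul (h i) trivial

variable (p : ℕ) [Fact p.Prime] [CharP A p] [PerfectRing A p]
include p

theorem frobRoot_dvd {k l : ℕ} (h : k ≤ l) (x : A) : frobRoot p l x ∣ frobRoot p k x := by
  induction l, h using Nat.le_induction with
  | base => rfl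
  | succ l _ ih => exact (Dvd.intro _ (frobRoot_succ_mul p l x)).trans ih

theorem exists_of_mem_radical_span_singleton_smul [IsReduced A] {F : Type*} [AddCommGroup F]
    [Module A F] {x : A} {b : F} {W : Submodule A F} (hb : b ∈ (Ideal.span {x}).radical • W) :
    ∃ k, ∃ c : F, b = frobRoot p k x • c := by
  refine Submodule.smul_induction_on hb (fun r hr n _ ↦ ?_) fun a b ha hb ↦ ?_
  · obtain ⟨k, c, rfl⟩ := exists_of_mem_radical_span_singleton p hr
    exact ⟨k, c • n, by rw [mul_smul]⟩
  · obtain ⟨k, c, rfl⟩ := ha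
    obtain ⟨l, d, rfl⟩ := hb
    obtain ⟨r, hr⟩ := frobRoot_dvd p (le_max_left k l) x
    obtain ⟨s, hs⟩ := frobRoot_dvd p (le_max_right k l) x
    exact ⟨max k l, r • c + s • d, by rw [smul_add, ← mul_smul, ← mul_smul, ← hr, ← hs]⟩

/-- Take `a + x_k c` in `ker f` with `a ∈ JF`. Then `x_k d(c) ∈ JF₀`, and radicality of `J`, applied
to coordinates, gives `d(t^(p-1) c) ∈ JF₀` for `t = x_(k+1)`. Vanishing for `L` corrects `t^(p-1) c`
by some `j ∈ JF` into `ker f`. The remainder `a + t j` lies in `ker f ∩ JF`, where vanishing for `N`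
applies. -/
theorem TorVanishing.sup_radical [IsReduced A] {n : ℕ} {J : Ideal A} (hJ : J.IsRadical)
    (h : TorVanishing n J) (x : A) : TorVanishing (n + 1) (J ⊔ (Ideal.span {x}).radical) := by
  intro F N _ _ _ _ _ f hN hf z hz
  obtain ⟨hzf, hz⟩ := hz
  have hN' := hN.of_succ
  obtain ⟨F₀, L, _, _, _, _, ι, g, _, hι, hg, hιg, hL⟩ := hN
  rw [Submodule.sup_smul] at hz ⊢
  obtain ⟨a, ha, b, hb, rfl⟩ := Submodule.mem_sup.1 hz
  obtain ⟨k, c, rfl⟩ := exists_of_mem_radical_span_singleton_smul p hb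
  set t := frobRoot p (k + 1) x
  have ht : t ∈ (Ideal.span {x}).radical :=
    frobRoot_mem_radical p (Ideal.mem_span_singleton_self x) _
  have htk : frobRoot p k x • c = t • t ^ (p - 1) • c := by
    rw [← mul_smul, frobRoot_succ_mul]
  let d : F →ₗ[A] F₀ := ι ∘ₗ f
  have hmap (y : F) (hy : y ∈ (J • ⊤ : Submodule A F)) : d y ∈ (J • ⊤ : Submodule A F₀) := by
    have := Submodule.mem_map_of_mem (f := d) hy
    rw [Submodule.map_smul''] at this
    exact Submodule.smul_mono le_rfl le_top this
  have hdb : frobRoot p k x • d c ∈ (J • ⊤ : Submodule A F₀) := by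
    have h0 : d a + frobRoot p k x • d c = 0 := by
      rw [← map_smul, ← map_add]
      exact (congrArg ι hzf).trans (map_zero ι)
    rw [eq_neg_of_add_eq_zero_right h0]
    exact neg_mem (hmap a ha)
  have hdc : d (t ^ (p - 1) • c) ∈ (J • ⊤ : Submodule A F₀) := by
    let e := Module.Free.chooseBasis A F₀
    rw [e.mem_ideal_smul_top_iff] at hdb ⊢
    intro i
    have := hdb i
    simp only [map_smul, Finsupp.smul_apply, smul_eq_mul] at this ⊢
    exact hJ.frobRoot_pow_mul_mem p this
  have hker : d (t ^ (p - 1) • c) ∈ LinearMap.ker g := hιg.apply_apply_eq_zero _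
  have hrange : LinearMap.ker g = Submodule.map d ⊤ := by
    rw [Submodule.map_comp, Submodule.map_top, LinearMap.range_eq_top.2 hf, Submodule.map_top]
    exact hιg.linearMap_ker_eq
  have hJg := h F₀ L g hL hg ⟨hker, hdc⟩
  rw [hrange, ← Submodule.map_smul''] at hJg
  obtain ⟨j, hj, hjd⟩ := hJg
  have hj' : t ^ (p - 1) • c - j ∈ LinearMap.ker f := by
    rw [LinearMap.mem_ker, map_sub, sub_eq_zero]
    exact hι hjd.symm
  have hsum : a + frobRoot p k x • c = (a + t • j) + t • (t ^ (p - 1) • c - j) := by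
    rw [htk, smul_sub]
    abel
  have hfirst : a + t • j ∈ LinearMap.ker f := by
    rw [eq_sub_of_add_eq hsum.symm]
    exact sub_mem hzf (Submodule.smul_mem _ _ hj')
  rw [hsum]
  exact add_mem (Submodule.mem_sup_left (h F N f hN' hf
    ⟨hfirst, add_mem ha (Submodule.smul_mem _ _ hj)⟩))
    (Submodule.mem_sup_right (Submodule.smul_mem_smul ht hj'))

theorem torVanishing_radical_span [IsReduced A] (s : Finset A) :
    TorVanishing s.card (Ideal.span (s : Set A)).radical := by
  classical
  induction s using Finset.induction_on with
  | empty =>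
    rw [Finset.coe_empty, Ideal.span_empty, (Ideal.isRadical_bot : (⊥ : Ideal A).IsRadical).radical]
    exact torVanishing_bot
  | insert x s hx ih =>
    rw [Finset.coe_insert, radical_span_insert p, Finset.card_insert_of_notMem hx]
    exact ih.sup_radical p (Ideal.radical_isRadical _) x

omit p in
-- A finitely presented module over a local ring is free once its `Tor₁` with the residue field
-- vanishes.
theorem TorVanishing.free [IsLocalRing A] {n : ℕ} (h : TorVanishing n (IsLocalRing.maximalIdeal A))
    {N : Type u} [AddCommGroup N] [Module A N] [Module.FinitePresentation A N]
    (hN : IsSyzygy (A := A) n N) : Module.Free A N := by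
  obtain ⟨m, f, hf⟩ := Module.Finite.exists_fin' A N
  have : Module.Finite A (LinearMap.ker f) :=
    Module.Finite.iff_fg.2 (Module.FinitePresentation.fg_ker f hf)
  refine Module.free_of_lTensor_residueField_injective (LinearMap.ker f).subtype f hf
    f.exact_subtype_ker_map ?_
  rw [injective_iff_map_eq_zero]
  intro z hz
  obtain ⟨y, rfl⟩ := TensorProduct.mk_surjective A (LinearMap.ker f) (IsLocalRing.ResidueField A)
    IsLocalRing.residue_surjective z
  have hker (Q : Type u) [AddCommGroup Q] [Module A Q] (q : Q) :
      (1 : IsLocalRing.ResidueField A) ⊗ₜ[A] q = 0 ↔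
        q ∈ (IsLocalRing.maximalIdeal A • ⊤ : Submodule A Q) := by
    rw [← LinearMap.ker_tensorProductMk]
    rfl
  have hz' : (1 : IsLocalRing.ResidueField A) ⊗ₜ[A] (y : Fin m → A) = 0 := hz
  refine (hker _ _).2 ?_
  have := h _ _ f hN hf ⟨y.2, (hker _ _).1 hz'⟩
  rwa [Submodule.mem_smul_top_iff]

omit p in
theorem TorVanishing.hasPdLT [IsLocalRing A] (hA : IsCoherentCommRing A) {d : ℕ}
    (h : TorVanishing d (IsLocalRing.maximalIdeal A)) (k n : ℕ) (hd : n + k = d)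
    {N : Type u} [AddCommGroup N] [Module A N] [Module.FinitePresentation A N]
    (hN : IsSyzygy (A := A) n N) : HasPdLT A N (k + 1) := by
  induction k generalizing n N with
  | zero =>
    obtain rfl : n = d := hd
    have := h.free hN
    exact .of_projective le_rfl
  | succ k ih =>
    obtain ⟨m, f, hf⟩ := Module.Finite.exists_fin' A N
    have := hA.finitePresentation_ker m f hf
    exact .of_ker f hf (ih (n + 1) (by lia) ⟨_, N, _, _, _, _, (LinearMap.ker f).subtype, f,
      inferInstance, Submodule.subtype_injective _, hf, f.exact_subtype_ker_map, hN⟩)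

omit p in
-- `A ⧸ I` is the colimit of the `A ⧸ J k`, so the telescope costs one dimension.
theorem HasPdLT.quotient_of_iUnion {I : Ideal A} {J : ℕ → Ideal A} (hmono : Monotone J)
    (hle : ∀ k, J k ≤ I) (hJ : ∀ x ∈ I, ∃ k, x ∈ J k) {n : ℕ} (h : ∀ k, HasPdLT A (A ⧸ J k) n) :
    HasPdLT A (A ⧸ I) (n + 1) := by
  let t (k : ℕ) : A ⧸ J k →ₗ[A] A ⧸ J (k + 1) := Submodule.factor (hmono k.le_succ)
  let c (k : ℕ) : A ⧸ J k →ₗ[A] A ⧸ I := Submodule.factor (hle k)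
  have ht (k : ℕ) (x : A) : t k (Submodule.Quotient.mk x) = Submodule.Quotient.mk x :=
    Submodule.factor_mk _ _
  have hc (k : ℕ) (x : A) : c k (Submodule.Quotient.mk x) = Submodule.Quotient.mk x :=
    Submodule.factor_mk _ _
  have hpush (k l : ℕ) (x : A) :
      telescopePush t k (Submodule.Quotient.mk x) l = Submodule.Quotient.mk x := by
    induction l with
    | zero => rw [telescopePush]
    | succ l ih => rw [telescopePush, ih, ht]
  refine HasPdLT.of_telescope (t := t) (c := c) ?_ ?_ ?_ h
  · intro k x
    obtain ⟨x, rfl⟩ := Submodule.Quotient.mk_surjective _ x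
    rw [ht, hc, hc]
  · intro y
    obtain ⟨y, rfl⟩ := Submodule.Quotient.mk_surjective _ y
    exact ⟨0, Submodule.Quotient.mk y, hc 0 y⟩
  · intro k x hx
    obtain ⟨x, rfl⟩ := Submodule.Quotient.mk_surjective _ x
    rw [hc, Submodule.Quotient.mk_eq_zero] at hx
    obtain ⟨l, hl⟩ := hJ x hx
    exact ⟨l, by rw [hpush, Submodule.Quotient.mk_eq_zero]; exact hmono (Nat.le_add_left l k) hl⟩

omit p in
theorem HasPdLT.quotient_of_forall_fg (hA : IsCountablyNoetherian A) {n : ℕ}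
    (h : ∀ I : Ideal A, I.FG → HasPdLT A (A ⧸ I) n) (I : Ideal A) :
    HasPdLT A (A ⧸ I) (n + 1) := by
  obtain ⟨v, hv⟩ := (hA A ⟨{1}, Set.countable_singleton _, by simp⟩ I).exists_nat
  let W (k : ℕ) : Submodule A I := Submodule.span A (v '' Set.Iio k)
  have hW : Monotone W := fun k l hkl ↦
    Submodule.span_mono (Set.image_mono (Set.Iio_subset_Iio hkl))
  refine .quotient_of_iUnion (J := fun k ↦ (W k).map I.subtype)
    (fun k l hkl ↦ Submodule.map_mono (hW hkl)) ?_ ?_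
    fun k ↦ h _ ((Submodule.fg_span ((Set.finite_Iio k).image v)).map _)
  · rintro k _ ⟨x, _, rfl⟩
    exact x.2
  · intro x hx
    have hx' : (⟨x, hx⟩ : I) ∈ Submodule.span A (⋃ k, v '' Set.Iio k) := by
      rw [← Set.image_iUnion, Set.iUnion_Iio, Set.image_univ, hv]
      exact Submodule.mem_top
    rw [Submodule.span_iUnion, Submodule.mem_iSup_of_directed _ hW.directed_le] at hx'
    obtain ⟨k, hk⟩ := hx'
    exact ⟨k, _, hk, rfl⟩

theorem globalDim_le_of_isCoherentCommRing [IsReduced A] [IsLocalRing A]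
    (hA : IsCoherentCommRing A) (hA' : IsCountablyNoetherian A) (s : Finset A)
    (hs : (Ideal.span (s : Set A)).radical = IsLocalRing.maximalIdeal A) :
    globalDim A ≤ (s.card + 1 : ℕ) := by
  have h := torVanishing_radical_span p s
  rw [hs] at h
  refine globalDim_le_of_forall_quotient fun I ↦ .quotient_of_forall_fg hA' (fun I hI ↦ ?_) I
  have : Module.FinitePresentation A (A ⧸ I) :=
    Module.finitePresentation_of_surjective _ I.mkQ_surjective (by rwa [Submodule.ker_mkQ])
  exact h.hasPdLT hA s.card 0 (zero_add _) trivial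

end Coherent

/-! ### Regular local rings: domains with maximal ideal generated by a regular sequence. -/

section RegularLocalRing

open IsLocalRing RingTheory.Sequence

theorem Ideal.exists_mem_notMem_sq_notMem_minimalPrimes {R : Type*} [CommRing R] [IsLocalRing R]
    [IsNoetherianRing R] (h : ringKrullDim R ≠ 0) :
    ∃ x ∈ maximalIdeal R, x ∉ maximalIdeal R ^ 2 ∧ ∀ q ∈ minimalPrimes R, x ∉ q := by
  classical
  have hfin := minimalPrimes.finite_of_isNoetherianRing R
  have hmin : maximalIdeal R ∉ minimalPrimes R := by
    intro hm
    refine h ?_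
    rw [← maximalIdeal_height_eq_ringKrullDim, Ideal.height_eq_zero_iff.2 hm]
    rfl
  by_contra! hcon
  have hsub : (maximalIdeal R : Set R) ⊆
      ⋃ i ∈ (↑(insert (maximalIdeal R ^ 2) hfin.toFinset) : Set (Ideal R)), (id i : Ideal R) := by
    intro x hx
    by_cases hx2 : x ∈ maximalIdeal R ^ 2
    · exact Set.mem_biUnion (by simp) hx2
    · obtain ⟨q, hq, hxq⟩ := hcon x hx hx2
      exact Set.mem_biUnion (by simp [hq]) hxq
  -- Prime avoidance tolerates two nonprime ideals; both exceptional slots are given to `𝔪 ^ 2`.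
  obtain ⟨q, hq, hmq⟩ := (Ideal.subset_union_prime (maximalIdeal R ^ 2) (maximalIdeal R ^ 2)
    (fun q hq hq2 _ ↦ (hfin.mem_toFinset.1 ((Finset.mem_insert.1 hq).resolve_left hq2)).1.1)).1 hsub
  obtain rfl | hq := Finset.mem_insert.1 hq
  · have hbot : maximalIdeal R = ⊥ := by
      refine Submodule.eq_bot_of_le_smul_of_le_jacobson_bot (maximalIdeal R) _
        (IsNoetherian.noetherian _) ?_ (maximalIdeal_le_jacobson _)
      simpa [sq] using hmq
    exact h (ringKrullDim_eq_zero_of_isField (isField_iff_maximalIdeal_eq.2 hbot))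
  · rw [hfin.mem_toFinset] at hq
    exact hmin ((maximalIdeal.isMaximal R).eq_of_le hq.1.1.ne_top hmq ▸ hq)

theorem IsLocalRing.map_quotientMk_maximalIdeal {R : Type*} [CommRing R] [IsLocalRing R]
    (I : Ideal R) [IsLocalRing (R ⧸ I)] :
    (maximalIdeal R).map (Ideal.Quotient.mk I) = maximalIdeal (R ⧸ I) :=
  have := IsLocalHom.of_surjective (Ideal.Quotient.mk I) Ideal.Quotient.mk_surjective
  map_maximalIdeal_of_surjective _ Ideal.Quotient.mk_surjective

/-- An element outside `𝔪 ^ 2` can be exchanged for a member of a generating set of `𝔪`. -/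
theorem IsLocalRing.spanFinrank_map_maximalIdeal_lt {R : Type*} [CommRing R] [IsLocalRing R]
    [IsNoetherianRing R] {x : R} (hx : x ∈ maximalIdeal R) (hx2 : x ∉ maximalIdeal R ^ 2) :
    ((maximalIdeal R).map (Ideal.Quotient.mk (Ideal.span {x}))).spanFinrank <
      (maximalIdeal R).spanFinrank := by
  classical
  obtain ⟨s, hs, hspan⟩ := Submodule.FG.exists_span_finset_card_eq_spanFinrank
    (IsNoetherian.noetherian (maximalIdeal R))
  have hsm (y : R) (hy : y ∈ s) : y ∈ maximalIdeal R := hspan ▸ Submodule.subset_span hy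
  obtain ⟨a, ha⟩ := Submodule.mem_span_finset'.1 (hspan.symm ▸ hx)
  obtain ⟨⟨y, hy⟩, hya⟩ : ∃ y : s, IsUnit (a y) := by
    by_contra! hcon
    refine hx2 (ha ▸ Ideal.sum_mem _ fun y _ ↦ ?_)
    rw [sq, smul_eq_mul]
    exact Ideal.mul_mem_mul (hcon y) (hsm y y.2)
  have hmap : (maximalIdeal R).map (Ideal.Quotient.mk (Ideal.span {x})) =
      Ideal.span ((s.erase y).image (Ideal.Quotient.mk (Ideal.span {x})) : Set _) := by
    refine le_antisymm ?_ ?_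
    · rw [Ideal.map_le_iff_le_comap]
      conv_lhs => rw [← hspan]
      set T := Ideal.comap (Ideal.Quotient.mk (Ideal.span {x}))
        (Ideal.span ((s.erase y).image (Ideal.Quotient.mk (Ideal.span {x})) : Set _))
      have hne (z : R) (hz : z ∈ s) (hzy : z ≠ y) : z ∈ T :=
        Ideal.subset_span (Finset.mem_image_of_mem _ (Finset.mem_erase.2 ⟨hzy, hz⟩))
      have hxT : x ∈ T := by
        rw [Ideal.mem_comap, Ideal.Quotient.eq_zero_iff_mem.2 (Ideal.mem_span_singleton_self x)]
        exact zero_mem _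
      have hyT : a ⟨y, hy⟩ * y ∈ T := by
        have hsum := Finset.add_sum_erase Finset.univ (fun z : s ↦ a z • (z : R))
          (Finset.mem_univ ⟨y, hy⟩)
        rw [ha] at hsum
        refine (Submodule.add_mem_iff_left T (Submodule.sum_mem T fun z hz ↦ ?_)).1
          (hsum.symm ▸ hxT)
        exact T.mul_mem_left _ (hne z z.2 fun h ↦ Finset.ne_of_mem_erase hz (Subtype.ext h))
      refine Submodule.span_le.2 fun z hz ↦ ?_
      obtain rfl | hzy := eq_or_ne z y
      exacts [(Ideal.unit_mul_mem_iff_mem T hya).1 hyT, hne z hz hzy]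
    · rw [Ideal.span_le]
      intro z hz
      obtain ⟨w, hw, rfl⟩ := Finset.mem_image.1 hz
      exact Ideal.mem_map_of_mem _ (hsm w (Finset.mem_of_mem_erase hw))
  rw [hmap, ← hs]
  refine (Submodule.spanFinrank_span_le_ncard_of_finite (Finset.finite_toSet _)).trans_lt ?_
  rw [Set.ncard_coe_finset]
  exact Finset.card_image_le.trans_lt (Finset.card_erase_lt_of_mem hy)

/-- Passing to the quotient lowers the dimension by at most one and the embedding dimension by at
least one. They agree for `R`, and dimension never exceeds embedding dimension, so both drop by
exactly one. -/
theorem IsRegularLocalRing.quotient_span_singleton {R : Type*} [CommRing R] [IsRegularLocalRing R]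
    {x : R} (hx : x ∈ maximalIdeal R) (hx2 : x ∉ maximalIdeal R ^ 2) :
    IsRegularLocalRing (R ⧸ Ideal.span {x}) ∧
      ringKrullDim R = ringKrullDim (R ⧸ Ideal.span {x}) + 1 := by
  have hne : Ideal.span {x} ≠ ⊤ := by
    rw [ne_eq, Ideal.span_singleton_eq_top]
    exact hx
  have := Ideal.Quotient.nontrivial_iff.2 hne
  have := IsLocalRing.of_surjective' (Ideal.Quotient.mk (Ideal.span {x}))
    Ideal.Quotient.mk_surjective
  have h1 := spanFinrank_map_maximalIdeal_lt hx hx2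
  rw [map_quotientMk_maximalIdeal] at h1
  have h2 : ringKrullDim R ≤ ringKrullDim (R ⧸ Ideal.span {x}) + 1 := by
    rw [← maximalIdeal_height_eq_ringKrullDim]
    exact Ideal.height_le_ringKrullDim_quotient_add_one hx
  have h3 := IsRegularLocalRing.spanFinrank_maximalIdeal (R := R)
  have h4 : ((maximalIdeal (R ⧸ Ideal.span {x})).spanFinrank : WithBot ℕ∞) + 1 ≤
      ringKrullDim R := by
    rw [← h3]
    exact_mod_cast h1
  have h5 := ringKrullDim_le_spanFinrank_maximalIdeal (R ⧸ Ideal.span {x})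
  refine ⟨.of_spanFinrank_maximalIdeal_le _ ?_, le_antisymm h2 ?_⟩
  · exact ENat.WithBot.add_le_add_one_right_iff.1 (h4.trans h2)
  · exact (add_le_add_left h5 1).trans h4

theorem IsRegularLocalRing.isDomain_and_exists_isWeaklyRegular (d : ℕ) (R : Type u) [CommRing R]
    [IsRegularLocalRing R] (hd : ringKrullDim R = d) :
    IsDomain R ∧ ∃ rs : List R, IsWeaklyRegular R rs ∧ Ideal.ofList rs = maximalIdeal R := by
  induction d generalizing R with
  | zero =>
    have hbot : maximalIdeal R = ⊥ := by
      have := IsRegularLocalRing.spanFinrank_maximalIdeal (R := R)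
      rw [hd] at this
      rw [← Submodule.spanFinrank_eq_zero_iff_eq_bot (IsNoetherian.noetherian _)]
      exact_mod_cast this
    exact ⟨(isField_iff_maximalIdeal_eq.2 hbot).isDomain, [], .nil R R, by simp [hbot]⟩
  | succ d ih =>
    obtain ⟨x, hx, hx2, hxq⟩ := Ideal.exists_mem_notMem_sq_notMem_minimalPrimes (R := R) (by
      rw [hd]
      exact_mod_cast d.succ_ne_zero)
    obtain ⟨hreg, hdim⟩ := IsRegularLocalRing.quotient_span_singleton hx hx2
    have hd' : ringKrullDim (R ⧸ Ideal.span {x}) = d := by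
      rw [hd, Nat.cast_succ] at hdim
      exact (ENat.WithBot.add_one_cancel.1 hdim).symm
    obtain ⟨hdom, rs', hrs', hm⟩ := ih _ hd'
    have hprime : (Ideal.span {x}).IsPrime := Ideal.Quotient.isDomain_iff_prime _ |>.1 hdom
    have hR : IsDomain R := by
      obtain ⟨q, hq, hqx⟩ := Ideal.exists_minimalPrimes_le (J := Ideal.span {x}) bot_le
      have hxnq := hxq q hq
      -- A minimal prime `q` inside the prime `(x)` does not contain `x`, so `q = x q` and Nakayama
      -- applies.
      have hqbot : q = ⊥ := by
        refine Submodule.eq_bot_of_le_smul_of_le_jacobson_bot (Ideal.span {x}) _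
          (IsNoetherian.noetherian _) (fun y hy ↦ ?_)
          (((Ideal.span_singleton_le_iff_mem _).2 hx).trans (maximalIdeal_le_jacobson _))
        obtain ⟨a, rfl⟩ := Ideal.mem_span_singleton.1 (hqx hy)
        exact Submodule.smul_mem_smul (Ideal.mem_span_singleton_self x)
          ((hq.1.1.mem_or_mem hy).resolve_left hxnq)
      have : (⊥ : Ideal R).IsPrime := hqbot ▸ hq.1.1
      exact IsDomain.of_bot_isPrime R
    refine ⟨hR, ?_⟩
    obtain ⟨rs, rfl⟩ := List.map_surjective_iff.2 Ideal.Quotient.mk_surjective rs'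
    refine ⟨x :: rs, ?_, ?_⟩
    · have hx0 : x ≠ 0 := fun h0 ↦ hx2 (h0 ▸ zero_mem _)
      rw [isWeaklyRegular_cons_iff]
      refine ⟨fun a b hab ↦ mul_left_cancel₀ hx0 hab, ?_⟩
      have h1 : IsWeaklyRegular (R ⧸ Ideal.span {x}) rs :=
        (isWeaklyRegular_map_algebraMap_iff (R ⧸ Ideal.span {x}) _ rs).1 hrs'
      refine ((Submodule.quotEquivOfEq _ _ ?_).isWeaklyRegular_congr rs).1 h1
      rw [← Submodule.ideal_span_singleton_smul, smul_eq_mul, Ideal.mul_top]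
    · have := congrArg (Ideal.comap (Ideal.Quotient.mk (Ideal.span {x}))) hm
      rw [← Ideal.map_ofList, Ideal.comap_map_of_surjective _ Ideal.Quotient.mk_surjective,
        ← RingHom.ker_eq_comap_bot, Ideal.mk_ker] at this
      have hloc := IsLocalHom.of_surjective (Ideal.Quotient.mk (Ideal.span {x}))
        Ideal.Quotient.mk_surjective
      rw [IsLocalRing.maximalIdeal_comap] at this
      rw [Ideal.ofList_cons, sup_comm, this]

end RegularLocalRing

/-! ### Powers of regular sequences. -/

section PowersOfRegularSequences

open RingTheory.Sequence IsLocalRing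

/-- The last member of a regular sequence may be replaced by a power; over a local ring sequences
can be permuted, so each member takes its turn at the end. -/
theorem RingTheory.Sequence.IsWeaklyRegular.map_pow {R : Type*} [CommRing R] [IsLocalRing R]
    [IsNoetherianRing R] (n : ℕ) (hn : n ≠ 0) (rs : List R) (hrs : ∀ r ∈ rs, r ∈ maximalIdeal R)
    {M : Type*} [AddCommGroup M] [Module R M] [Module.Finite R M] (h : IsWeaklyRegular M rs) :
    IsWeaklyRegular M (rs.map (· ^ n)) := by
  induction rs generalizing M with
  | nil => exact .nil R M
  | cons r rs ih =>
    rw [isWeaklyRegular_cons_iff] at h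
    have hrs' : ∀ s ∈ rs, s ∈ maximalIdeal R := fun s hs ↦ hrs s (List.mem_cons_of_mem _ hs)
    have hr := hrs r List.mem_cons_self
    have hpow : ∀ s ∈ rs.map (· ^ n), s ∈ maximalIdeal R := by
      intro s hs
      obtain ⟨t, ht, rfl⟩ := List.mem_map.1 hs
      exact Ideal.pow_mem_of_mem _ (hrs' t ht) n hn.bot_lt
    have h1 : IsWeaklyRegular M (r :: rs.map (· ^ n)) :=
      (isWeaklyRegular_cons_iff M r _).2 ⟨h.1, ih hrs' h.2⟩
    have h2 := isWeaklyRegular_of_perm_of_subset_maximalIdeal h1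
      (List.perm_append_singleton r _).symm
      (by simpa only [List.forall_mem_cons] using ⟨hr, hpow⟩)
    rw [isWeaklyRegular_append_iff, isWeaklyRegular_singleton_iff] at h2
    have h3 : IsWeaklyRegular M (rs.map (· ^ n) ++ [r ^ n]) := by
      rw [isWeaklyRegular_append_iff, isWeaklyRegular_singleton_iff]
      exact ⟨h2.1, h2.2.pow n⟩
    refine isWeaklyRegular_of_perm_of_subset_maximalIdeal h3
      (List.perm_append_singleton (r ^ n) _) ?_
    intro s hs
    obtain hs | hs := List.mem_append.1 hs
    · exact hpow s hs
    · rw [List.mem_singleton.1 hs]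
      exact Ideal.pow_mem_of_mem _ hr n hn.bot_lt

end PowersOfRegularSequences

/-! ### `Tor₁` and the sequence `0 → (I : a) → I × R → I + (a) → 0`. -/

section IdealTensor

open TensorProduct

variable {R : Type*} [CommRing R] (I : Ideal R) (a : R)

/-- The colon ideal `I : a`. -/
abbrev colonElem : Ideal R := Submodule.comap (LinearMap.lsmul R R a) I

/-- Multiplication by `a` as a map `(I : a) → I`. -/
def colonMul : colonElem I a →ₗ[R] I := (LinearMap.lsmul R R a).restrict fun _ h ↦ h

/-- The map `I × R → I + (a)`. -/
def supSpanMap : I × R →ₗ[R] (I ⊔ Ideal.span {a} : Ideal R) :=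
  (Submodule.inclusion le_sup_left).coprod
    (LinearMap.toSpanSingleton R _ ⟨a, Ideal.mem_sup_right (Ideal.mem_span_singleton_self a)⟩)

theorem supSpanMap_apply (x : I × R) : (supSpanMap I a x : R) = x.1 + x.2 * a := by
  simp [supSpanMap]

theorem supSpanMap_surjective : Function.Surjective (supSpanMap I a) := by
  rintro ⟨x, hx⟩
  obtain ⟨i, hi, j, hj, rfl⟩ := Submodule.mem_sup.1 hx
  obtain ⟨c, rfl⟩ := Ideal.mem_span_singleton.1 hj
  exact ⟨(⟨i, hi⟩, c), Subtype.ext (by rw [supSpanMap_apply, mul_comm])⟩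

theorem exact_supSpanMap :
    Function.Exact ((-colonMul I a).prod (colonElem I a).subtype) (supSpanMap I a) := by
  rintro ⟨⟨i, hi⟩, r⟩
  rw [Subtype.ext_iff, supSpanMap_apply]
  constructor
  · intro h
    have h' : i = -(a * r) := by rw [mul_comm]; exact eq_neg_of_add_eq_zero_left h
    refine ⟨⟨r, ?_⟩, Prod.ext (Subtype.ext ?_) rfl⟩
    · have := I.neg_mem hi
      rwa [h', neg_neg] at this
    · exact h'.symm
  · rintro ⟨⟨s, hs⟩, h⟩
    rw [← h]
    simp [colonMul, mul_comm]

variable {I a} {M : Type*} [AddCommGroup M] [Module R M]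

/-- If `Tor₁(M, R ⧸ (I + (a))) = 0`, then `Tor₁(M, R ⧸ (I : a))` surjects onto `Tor₁(M, R ⧸ I)`. -/
theorem exists_of_lTensor_sup_injective
    (h : Function.Injective ((I ⊔ Ideal.span {a} : Ideal R).subtype.lTensor M))
    {z : M ⊗[R] I} (hz : I.subtype.lTensor M z = 0) :
    ∃ k : M ⊗[R] colonElem I a, (colonElem I a).subtype.lTensor M k = 0 ∧
      z = -(colonMul I a).lTensor M k := by
  have hφ : (supSpanMap I a).lTensor M ((LinearMap.inl R I R).lTensor M z) = 0 := by
    refine h ?_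
    rw [map_zero, ← LinearMap.lTensor_comp_apply, ← LinearMap.lTensor_comp_apply, ← hz]
    congr 2
    ext
    simp [supSpanMap_apply]
  obtain ⟨k, hk⟩ := (lTensor_exact M (exact_supSpanMap I a) (supSpanMap_surjective I a) _).1 hφ
  refine ⟨k, ?_, ?_⟩
  · have := congrArg ((LinearMap.snd R I R).lTensor M) hk
    rwa [← LinearMap.lTensor_comp_apply, ← LinearMap.lTensor_comp_apply, LinearMap.snd_prod,
      LinearMap.snd_comp_inl, LinearMap.lTensor_zero, LinearMap.zero_apply] at this
  · have := congrArg ((LinearMap.fst R I R).lTensor M) hk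
    rwa [← LinearMap.lTensor_comp_apply, ← LinearMap.lTensor_comp_apply, LinearMap.fst_prod,
      LinearMap.fst_comp_inl, LinearMap.lTensor_id, LinearMap.id_apply, LinearMap.lTensor_neg,
      LinearMap.neg_apply, eq_comm] at this

theorem TensorProduct.prodRight_apply {N P : Type*} [AddCommGroup N] [Module R N] [AddCommGroup P]
    [Module R P] (x : M ⊗[R] (N × P)) : TensorProduct.prodRight R R M N P x =
      ((LinearMap.fst R N P).lTensor M x, (LinearMap.snd R N P).lTensor M x) := by
  induction x with
  | zero => rw [map_zero, map_zero, map_zero, Prod.mk_zero_zero]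
  | add x y hx hy => simp [hx, hy]
  | tmul m y => simp

theorem mem_smul_top_iff_exists_lTensor (m : M) :
    m ∈ (I • ⊤ : Submodule R M) ↔
      ∃ k : M ⊗[R] I, TensorProduct.rid R M (I.subtype.lTensor M k) = m := by
  constructor
  · intro hm
    refine Submodule.smul_induction_on hm (fun r hr n _ ↦ ⟨n ⊗ₜ ⟨r, hr⟩, by simp⟩) ?_
    rintro _ _ ⟨k, rfl⟩ ⟨l, rfl⟩
    exact ⟨k + l, by simp⟩
  · rintro ⟨k, rfl⟩
    induction k with
    | zero => simp
    | add x y hx hy => simpa using add_mem hx hy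
    | tmul m i => simpa using Submodule.smul_mem_smul i.2 (Submodule.mem_top (x := m))

/-- `Tor₁` vanishing persists when a regular element is added to an ideal. -/
theorem lTensor_sup_injective_of_isSMulRegular (h : Function.Injective (I.subtype.lTensor M))
    (ha : IsSMulRegular (M ⧸ (I • ⊤ : Submodule R M)) a) :
    Function.Injective ((I ⊔ Ideal.span {a} : Ideal R).subtype.lTensor M) := by
  rw [injective_iff_map_eq_zero]
  intro z hz
  obtain ⟨w, rfl⟩ := LinearMap.lTensor_surjective M (supSpanMap_surjective I a) z
  set w₁ := (LinearMap.fst R I R).lTensor M w with hw₁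
  set w₂ := (LinearMap.snd R I R).lTensor M w with hw₂
  have hsum : I.subtype.lTensor M w₁ + a • w₂ = 0 := by
    rw [← hz, hw₁, hw₂, ← LinearMap.lTensor_comp_apply, ← LinearMap.lTensor_comp_apply,
      ← LinearMap.smul_apply, ← LinearMap.lTensor_smul, ← LinearMap.add_apply,
      ← LinearMap.lTensor_add]
    congr 2
    ext <;> simp [supSpanMap_apply]
  -- Regularity of `a` on `M ⧸ IM` lifts `w₂` to `M ⊗ I`. Through `I ≤ (I : a)` this lift provides
  -- the preimage of `w`, which forces `z = 0`.
  have hm : TensorProduct.rid R M w₂ ∈ (I • ⊤ : Submodule R M) := by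
    refine mem_of_isSMulRegular_quotient_of_smul_mem ha ?_
    rw [← map_smul, eq_neg_of_add_eq_zero_right hsum, map_neg]
    exact neg_mem ((mem_smul_top_iff_exists_lTensor _).2 ⟨w₁, rfl⟩)
  obtain ⟨k, hk⟩ := (mem_smul_top_iff_exists_lTensor _).1 hm
  have hk := (TensorProduct.rid R M).injective hk
  have hle : I ≤ colonElem I a := fun i hi ↦ I.mul_mem_left a hi
  set k' := (Submodule.inclusion hle).lTensor M k with hk'
  have hw : ((-colonMul I a).prod (colonElem I a).subtype).lTensor M k' = w := by
    refine (TensorProduct.prodRight R R M I R).injective ?_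
    rw [TensorProduct.prodRight_apply, TensorProduct.prodRight_apply, ← hw₁, ← hw₂,
      ← LinearMap.lTensor_comp_apply, LinearMap.fst_prod,
      ← LinearMap.lTensor_comp_apply M (LinearMap.snd R I R), LinearMap.snd_prod, hk',
      ← LinearMap.lTensor_comp_apply, ← LinearMap.lTensor_comp_apply]
    refine Prod.ext ?_ hk
    have hcomp : -colonMul I a ∘ₗ Submodule.inclusion hle = -(a • LinearMap.id) := by
      ext
      simp [colonMul]
    change (-colonMul I a ∘ₗ Submodule.inclusion hle).lTensor M k = w₁
    rw [hcomp, LinearMap.lTensor_neg, LinearMap.lTensor_smul, LinearMap.lTensor_id]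
    refine h ?_
    rw [eq_neg_of_add_eq_zero_left hsum, ← hk]
    simp
  exact (lTensor_exact M (exact_supSpanMap I a) (supSpanMap_surjective I a) _).2 ⟨k', hw⟩

theorem lTensor_ofList_injective (rs : List R) (h : RingTheory.Sequence.IsWeaklyRegular M rs) :
    Function.Injective ((Ideal.ofList rs).subtype.lTensor M) := by
  induction rs using List.reverseRecOn with
  | nil =>
    rw [Ideal.ofList_nil]
    have : Subsingleton (M ⊗[R] (⊥ : Ideal R)) := by
      refine subsingleton_of_forall_eq 0 fun x ↦ ?_
      induction x with
      | zero => rfl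
      | add x y hx hy => rw [hx, hy, add_zero]
      | tmul m y => rw [Subsingleton.elim y 0, TensorProduct.tmul_zero]
    exact Function.injective_of_subsingleton _
  | append_singleton rs r ih =>
    rw [RingTheory.Sequence.isWeaklyRegular_append_iff,
      RingTheory.Sequence.isWeaklyRegular_singleton_iff] at h
    rw [Ideal.ofList_append, Ideal.ofList_singleton]
    exact lTensor_sup_injective_of_isSMulRegular (ih h.1) h.2

end IdealTensor

/-! ### The local criterion and flatness of Frobenius. -/

section LocalCriterion

open TensorProduct IsLocalRing

/-- The local criterion of flatness. -/
theorem Module.Flat.of_lTensor_maximalIdeal_injective {R S : Type*} [CommRing R] [CommRing S]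
    [Algebra R S] [IsLocalRing R] [IsNoetherianRing R] [IsLocalRing S] [IsNoetherianRing S]
    (hRS : ∀ r ∈ maximalIdeal R, algebraMap R S r ∈ maximalIdeal S)
    (h : Function.Injective ((maximalIdeal R).subtype.lTensor S)) : Module.Flat R S := by
  rw [Module.Flat.iff_lTensor_injective']
  intro I
  -- Noetherian induction: for `a ∈ 𝔪 \ I`, `Tor₁(S, R ⧸ (I : a))` surjects onto `Tor₁(S, R ⧸ I)`.
  -- If `I : a` is larger, the source vanishes; if it equals `I`, the surjection is multiplication
  -- by `a` up to sign, and Nakayama over `S` applies.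
  induction I using WellFoundedGT.induction with
  | ind I ih =>
  obtain hI | hI := eq_or_ne I ⊤
  · have : Function.Injective I.subtype ∧ Function.Surjective I.subtype :=
      ⟨Subtype.val_injective, fun x ↦ ⟨⟨x, hI ▸ trivial⟩, rfl⟩⟩
    exact ((LinearEquiv.ofBijective I.subtype this).lTensor S).injective
  obtain rfl | hIm := eq_or_ne I (maximalIdeal R)
  · exact h
  obtain ⟨a, ham, haI⟩ := SetLike.exists_of_lt ((le_maximalIdeal hI).lt_of_ne hIm)
  have hsup : I < I ⊔ Ideal.span {a} :=
    left_lt_sup.2 fun hle ↦ haI (hle (Ideal.mem_span_singleton_self a))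
  have hle : I ≤ colonElem I a := fun i hi ↦ I.mul_mem_left a hi
  have key {z : S ⊗[R] I} (hz : I.subtype.lTensor S z = 0) :=
    exists_of_lTensor_sup_injective (ih _ hsup) hz
  obtain hlt | heq := hle.lt_or_eq
  · rw [injective_iff_map_eq_zero]
    intro z hz
    obtain ⟨k, hk, rfl⟩ := key hz
    rw [(injective_iff_map_eq_zero _).1 (ih _ hlt) k hk, map_zero, neg_zero]
  · let f : S ⊗[R] I →ₗ[S] S ⊗[R] R := I.subtype.baseChange S
    change Function.Injective f
    rw [← LinearMap.ker_eq_bot]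
    refine Submodule.eq_bot_of_le_smul_of_le_jacobson_bot (maximalIdeal S) _
      (IsNoetherian.noetherian _) (fun z hz ↦ ?_) (maximalIdeal_le_jacobson _)
    obtain ⟨k, hk, rfl⟩ := key hz
    let e : colonElem I a →ₗ[R] I := Submodule.inclusion heq.ge
    have hmul : colonMul I a = a • e := rfl
    have hek : e.lTensor S k ∈ LinearMap.ker f := by
      change I.subtype.lTensor S (e.lTensor S k) = 0
      rw [← LinearMap.lTensor_comp_apply]
      exact hk
    rw [hmul, LinearMap.lTensor_smul, LinearMap.smul_apply, ← algebraMap_smul S a]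
    exact neg_mem (Submodule.smul_mem_smul (hRS a ham) hek)

theorem IsRegularLocalRing.flat_of_isWeaklyRegular {R S : Type*} [CommRing R] [CommRing S]
    [IsLocalRing R] [IsNoetherianRing R] [IsLocalRing S] [IsNoetherianRing S] (φ : R →+* S)
    [IsLocalHom φ] (rs : List R) (hrs : Ideal.ofList rs = maximalIdeal R)
    (h : RingTheory.Sequence.IsWeaklyRegular S (rs.map φ)) : φ.Flat := by
  let : Algebra R S := φ.toAlgebra
  refine Module.Flat.of_lTensor_maximalIdeal_injective (fun r hr ↦ ?_) ?_
  · exact (map_mem_nonunits_iff φ r).2 hr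
  · rw [← hrs]
    exact lTensor_ofList_injective rs
      ((RingTheory.Sequence.isWeaklyRegular_map_algebraMap_iff S S rs).1 h)

/-- Powers of the Frobenius endomorphism of a regular local ring are flat. -/
theorem IsRegularLocalRing.flat_iterateFrobenius (R : Type u) [CommRing R] [IsRegularLocalRing R]
    (p : ℕ) [Fact p.Prime] [CharP R p] (n : ℕ) : (iterateFrobenius R p n).Flat := by
  obtain ⟨d, hd⟩ : ∃ d : ℕ, ringKrullDim R = d :=
    ⟨_, (IsRegularLocalRing.spanFinrank_maximalIdeal (R := R)).symm⟩
  obtain ⟨-, rs, hrs, hm⟩ := IsRegularLocalRing.isDomain_and_exists_isWeaklyRegular d R hd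
  have hpn : p ^ n ≠ 0 := NeZero.ne _
  have : IsLocalHom (iterateFrobenius R p n) :=
    ⟨fun a ha ↦ by rwa [iterateFrobenius_def, isUnit_pow_iff hpn] at ha⟩
  refine IsRegularLocalRing.flat_of_isWeaklyRegular _ rs hm ?_
  exact hrs.map_pow (p ^ n) hpn rs fun r hr ↦ hm ▸ Ideal.subset_span hr

end LocalCriterion

/-! ### Descent from a purely inseparable perfect extension to `R`. -/

section PerfectClosure

variable {R A : Type u} [CommRing R] [CommRing A] (p : ℕ) [Fact p.Prime] [CharP R p] [CharP A p]
  [PerfectRing A p] {i : R →+* A}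

omit [CharP R p] in
theorem frobRoot_map_pow (i : R →+* A) (n : ℕ) (r : R) : frobRoot p n (i (r ^ p ^ n)) = i r := by
  rw [map_pow, frobRoot_pow_self]

omit [Fact p.Prime] [CharP R p] [CharP A p] [PerfectRing A p] in
theorem map_eq_pow_of_le {a : A} {m n : ℕ} (hmn : m ≤ n) {r : R} (h : i r = a ^ p ^ m) :
    i (r ^ p ^ (n - m)) = a ^ p ^ n := by
  rw [map_pow, h, ← pow_mul, ← pow_add, Nat.add_sub_cancel' hmn]

omit [Fact p.Prime] [CharP R p] [CharP A p] [PerfectRing A p] in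
theorem exists_pow_forall {ι : Type*} [Finite ι] (hpow : ∀ a, ∃ n r, i r = a ^ p ^ n) (a : ι → A) :
    ∃ n, ∃ b : ι → R, ∀ l, i (b l) = a l ^ p ^ n := by
  have := Fintype.ofFinite ι
  choose m r hr using fun l ↦ hpow (a l)
  exact ⟨Finset.univ.sup m, fun l ↦ r l ^ p ^ (Finset.univ.sup m - m l),
    fun l ↦ map_eq_pow_of_le p (Finset.le_sup (Finset.mem_univ l)) (hr l)⟩

theorem RingHom.Flat.isTrivialRelation {S : Type*} [CommRing S] {φ : R →+* S} (hφ : φ.Flat) {l : ℕ}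
    {f : Fin l → R} {x : Fin l → S} (h : ∑ j, φ (f j) * x j = 0) :
    ∃ (k : ℕ) (a : Fin l → Fin k → R) (y : Fin k → S),
      (∀ j, x j = ∑ m, φ (a j m) * y m) ∧ ∀ m, ∑ j, f j * a j m = 0 := by
  let : Algebra R S := φ.toAlgebra
  have : Module.Flat R S := hφ
  exact Module.Flat.isTrivialRelation_of_sum_smul_eq_zero (f := f) (x := x) h

/-- Equational criterion: the `p ^ n`-th power of a linear relation has its unknowns in `R`.
Flatness of Frobenius trivializes it, and `p ^ n`-th roots trivialize the original one. -/
theorem RingHom.Flat.of_flat_iterateFrobenius (hi : Function.Injective i)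
    (hpow : ∀ a, ∃ n r, i r = a ^ p ^ n) (hF : ∀ n, (iterateFrobenius R p n).Flat) : i.Flat := by
  let : Algebra R A := i.toAlgebra
  refine Module.Flat.of_forall_isTrivialRelation fun {l f x} h ↦ ?_
  obtain ⟨n, b, hb⟩ := exists_pow_forall p hpow x
  have hsum : ∑ j, iterateFrobenius R p n (f j) * b j = 0 := by
    refine hi ?_
    rw [map_zero, map_sum, ← zero_pow (NeZero.ne (p ^ n)), ← h, sum_pow_char_pow]
    refine Finset.sum_congr rfl fun j _ ↦ ?_
    rw [map_mul, hb, iterateFrobenius_def, map_pow, Algebra.smul_def, mul_pow]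
    rfl
  obtain ⟨k, c, y, hc, hfc⟩ := (hF n).isTrivialRelation hsum
  refine ⟨k, c, fun m ↦ frobRoot p n (i (y m)), fun j ↦ ?_, hfc⟩
  rw [← frobRoot_eq_of_pow_eq p (hb j).symm, hc, map_sum, map_sum]
  refine Finset.sum_congr rfl fun m _ ↦ ?_
  rw [map_mul, map_mul, iterateFrobenius_def, frobRoot_map_pow]
  rfl

theorem Module.FinitePresentation.ideal_map {R A : Type*} [CommRing R] [CommRing A] [Algebra R A]
    [Module.Flat R A] (I : Ideal R) [Module.FinitePresentation R I] :
    Module.FinitePresentation A (I.map (algebraMap R A)) := by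
  let f : TensorProduct R A I →ₗ[A] A :=
    (TensorProduct.AlgebraTensorModule.rid R A A).toLinearMap ∘ₗ I.subtype.baseChange A
  have hf : Function.Injective f := (TensorProduct.AlgebraTensorModule.rid R A A).injective.comp
    (Module.Flat.lTensor_preserves_injective_linearMap _ I.subtype_injective)
  have hrange : LinearMap.range f = I.map (algebraMap R A) := by
    refine le_antisymm ?_ (Ideal.map_le_iff_le_comap.2 fun x hx ↦ ⟨1 ⊗ₜ ⟨x, hx⟩, ?_⟩)
    · rintro - ⟨x, rfl⟩
      induction x with
      | zero => simp
      | add x y hx hy => rw [map_add]; exact add_mem hx hy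
      | tmul a x =>
        have : f (a ⊗ₜ x) = algebraMap R A x * a := by simp [f, Algebra.smul_def]
        rw [this]
        exact Ideal.mul_mem_right _ _ (Ideal.mem_map_of_mem _ x.2)
    · simp [f, Algebra.smul_def]
  exact .of_equiv (LinearEquiv.ofInjective f hf ≪≫ₗ .ofEq _ _ hrange)

/-- A finitely generated ideal of `A` is extended from an ideal `I` of `R` along some `φ n`, and by
flatness it is the base change of `I`. -/
theorem isCoherentCommRing_of_flat [IsNoetherianRing R] (φ : ℕ → R →+* A) (hφ : ∀ n, (φ n).Flat)
    (h : ∀ s : Finset A, ∃ n, ∀ a ∈ s, a ∈ (φ n).range) : IsCoherentCommRing A := by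
  classical
  rintro I ⟨s, rfl⟩
  obtain ⟨n, hn⟩ := h s
  let : Algebra R A := (φ n).toAlgebra
  have : Module.Flat R A := hφ n
  obtain ⟨t, -, rfl⟩ := Finset.subset_set_image_iff.1 (show (s : Set A) ⊆ φ n '' Set.univ from
    fun a ha ↦ (hn a ha).imp fun r hr ↦ ⟨trivial, hr⟩)
  have : Module.FinitePresentation R (Ideal.span (t : Set R)) :=
    Module.finitePresentation_of_finite _ _
  have hmap := Module.FinitePresentation.ideal_map (A := A) (Ideal.span (t : Set R))
  rw [Ideal.map_span] at hmap
  rw [Finset.coe_image]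
  exact hmap

omit [CharP R p] in
theorem mem_range_frobRoot_comp {a : A} {n : ℕ} :
    a ∈ ((frobRoot (A := A) p n).toRingHom.comp i).range ↔ ∃ r, i r = a ^ p ^ n := by
  refine exists_congr fun r ↦ ⟨fun h ↦ ?_, fun h ↦ frobRoot_eq_of_pow_eq p h.symm⟩
  rw [← h]
  exact (frobRoot_pow p n (i r)).symm

theorem isCoherentCommRing_of_flat_iterateFrobenius [IsNoetherianRing R]
    (hi : Function.Injective i) (hpow : ∀ a, ∃ n r, i r = a ^ p ^ n)
    (hF : ∀ n, (iterateFrobenius R p n).Flat) : IsCoherentCommRing A := by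
  refine isCoherentCommRing_of_flat (fun n ↦ (frobRoot (A := A) p n).toRingHom.comp i)
    (fun n ↦ (RingHom.Flat.of_flat_iterateFrobenius p hi hpow hF).comp
      (.of_bijective (frobRoot (A := A) p n).bijective)) fun s ↦ ?_
  obtain ⟨n, b, hb⟩ := exists_pow_forall p hpow (Subtype.val : s → A)
  exact ⟨n, fun a ha ↦ (mem_range_frobRoot_comp p).2 ⟨b ⟨a, ha⟩, hb _⟩⟩

omit [CharP R p] in
theorem isCountablyNoetherian_of_pow_mem [IsNoetherianRing R]
    (hpow : ∀ a, ∃ n r, i r = a ^ p ^ n) : IsCountablyNoetherian A := by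
  refine .of_iUnion_range (fun n ↦ (frobRoot (A := A) p n).toRingHom.comp i) (fun m n hmn a ha ↦ ?_)
    fun a ↦ ?_
  · rw [mem_range_frobRoot_comp] at ha ⊢
    obtain ⟨r, hr⟩ := ha
    exact ⟨_, map_eq_pow_of_le p hmn hr⟩
  · obtain ⟨n, hn⟩ := hpow a
    exact ⟨n, (mem_range_frobRoot_comp p).2 hn⟩

omit [CharP R p] [CharP A p] [PerfectRing A p] in
theorem Ideal.IsPrime.eq_radical_map (hpow : ∀ a, ∃ n r, i r = a ^ p ^ n)
    {P : Ideal A} (hP : P.IsPrime) {I : Ideal R} (hI : I.radical = P.comap i) :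
    (I.map i).radical = P := by
  refine le_antisymm ?_ fun a ha ↦ ?_
  · rw [hP.isRadical.radical_le_iff, Ideal.map_le_iff_le_comap, ← hI]
    exact Ideal.le_radical
  · obtain ⟨n, r, hr⟩ := hpow a
    have : r ∈ I.radical := by
      rw [hI, Ideal.mem_comap, hr]
      exact P.pow_mem_of_mem ha _ (NeZero.pos _)
    obtain ⟨m, hm⟩ := this
    refine ⟨p ^ n * m, ?_⟩
    rw [pow_mul, ← hr, ← map_pow]
    exact Ideal.mem_map_of_mem i hm

omit [CharP R p] [PerfectRing A p] in
theorem isLocalRing_of_pow_mem [IsLocalRing R] [Nontrivial A] (hi : Function.Injective i)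
    (hpow : ∀ a, ∃ n r, i r = a ^ p ^ n) : IsLocalRing A ∧ IsLocalHom i := by
  have hloc : IsLocalHom i := by
    refine ⟨fun r ⟨u, hu⟩ ↦ ?_⟩
    obtain ⟨n, s, hs⟩ := hpow (↑u⁻¹ : A)
    have : i (r ^ p ^ n * s) = i 1 := by
      rw [map_mul, hs, map_pow, ← hu, ← mul_pow, Units.mul_inv, one_pow, map_one]
    exact (isUnit_pow_iff (NeZero.ne (p ^ n))).1 (IsUnit.of_mul_eq_one _ (hi this))
  refine ⟨IsLocalRing.of_nonunits_add fun a b ha hb ↦ ?_, hloc⟩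
  obtain ⟨m, r, hr⟩ := hpow a
  obtain ⟨n, s, hs⟩ := hpow b
  have hr' := map_eq_pow_of_le p (le_max_left m n) hr
  have hs' := map_eq_pow_of_le p (le_max_right m n) hs
  have key {c : A} {t : R} (h : i t = c ^ p ^ max m n) : c ∈ nonunits A ↔ t ∈ nonunits R := by
    rw [← map_mem_nonunits_iff i t, h, mem_nonunits_iff, mem_nonunits_iff,
      isUnit_pow_iff (NeZero.ne (p ^ max m n))]
  rw [key hr'] at ha
  rw [key hs'] at hb
  exact (key (by rw [map_add, hr', hs', add_pow_char_pow])).2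
    (IsLocalRing.nonunits_add ha hb)

end PerfectClosure

/-! ### Primes in dimension at most two, up to radical. -/

section PrimesOfSmallDimension

variable {R : Type u} [CommRing R] [IsDomain R] [IsLocalRing R] [IsNoetherianRing R]

omit [IsNoetherianRing R] in
theorem three_le_ringKrullDim {q' q : Ideal R} [hq' : q'.IsPrime] [hq : q.IsPrime] (h₀ : q' ≠ ⊥)
    (h₁ : q' < q) (h₂ : q ≠ IsLocalRing.maximalIdeal R) : 3 ≤ ringKrullDim R := by
  let P₀ : PrimeSpectrum R := ⟨⊥, Ideal.isPrime_bot⟩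
  let P₁ : PrimeSpectrum R := ⟨q', hq'⟩
  let P₂ : PrimeSpectrum R := ⟨q, hq⟩
  let P₃ : PrimeSpectrum R := ⟨IsLocalRing.maximalIdeal R, inferInstance⟩
  have l₁ : P₀ < P₁ := show (⊥ : Ideal R) < q' from bot_lt_iff_ne_bot.2 h₀
  have l₂ : P₁ < P₂ := h₁
  have l₃ : P₂ < P₃ := lt_of_le_of_ne (IsLocalRing.le_maximalIdeal hq.ne_top)
    fun h ↦ h₂ (congrArg PrimeSpectrum.asIdeal h)
  have h := (add_le_add_left ((add_le_add_left (Order.height_add_one_le l₁) 1).trans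
    (Order.height_add_one_le l₂)) 1).trans (Order.height_add_one_le l₃)
  have h3 : (3 : ℕ∞) ≤ Order.height P₃ := by
    refine le_trans ?_ h
    rw [add_assoc, add_assoc]
    exact le_add_self
  exact (WithBot.coe_le_coe.2 h3).trans (Order.height_le_krullDim P₃)

/-- For `q ≠ 0`, choose `x ≠ 0` in `q`, then `y ∈ q` outside all minimal primes of `(x)` other than
`q`. A prime over `(x, y)` contains a minimal prime `P` of `(x)`: either `y ∈ P`, so `P = q`, or the
prime strictly contains `P ≠ 0` and is maximal by dimension. -/
theorem exists_finset_radical_span_eq (hR : ringKrullDim R < 3) {q : Ideal R} [hq : q.IsPrime]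
    (hm : q ≠ IsLocalRing.maximalIdeal R) :
    ∃ s : Finset R, s.card ≤ 2 ∧ (Ideal.span (s : Set R)).radical = q := by
  classical
  by_cases h₀ : q = ⊥
  · subst h₀
    exact ⟨∅, by simp, by simp⟩
  obtain ⟨x, hxq, hx⟩ := Submodule.exists_mem_ne_zero_of_ne_bot h₀
  let S := (Ideal.span {x}).finite_minimalPrimes_of_isNoetherianRing.toFinset
  have hS {P : Ideal R} : P ∈ S ↔ P ∈ (Ideal.span {x}).minimalPrimes := Set.Finite.mem_toFinset _
  have key {P : Ideal R} (hP : P ∈ S) (hPq : P ≤ q) : P = q := by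
    by_contra hne
    have : P.IsPrime := (hS.1 hP).1.1
    refine hR.not_ge (three_le_ringKrullDim (q' := P) ?_ (lt_of_le_of_ne hPq hne) hm)
    rintro rfl
    exact hx ((hS.1 hP).1.2 (Ideal.mem_span_singleton_self x))
  have havoid : ∃ y ∈ q, ∀ P ∈ S, y ∈ P → P = q := by
    by_contra! h
    obtain ⟨P, hP, hqP⟩ := (Ideal.subset_union_prime (s := S.erase q) (f := id) q q
      (fun P hP _ _ ↦ (hS.1 (Finset.mem_of_mem_erase hP)).1.1) (I := q)).1 fun y hy ↦ by
        obtain ⟨P, hP, hyP, hne⟩ := h y hy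
        exact Set.mem_biUnion (x := P) (Finset.mem_coe.2 (Finset.mem_erase.2 ⟨hne, hP⟩)) hyP
    have hPS := Finset.mem_of_mem_erase hP
    exact Finset.ne_of_mem_erase hP (key hPS
      ((hS.1 hPS).2 ⟨hq, (Ideal.span_singleton_le_iff_mem q).2 hxq⟩ hqP))
  obtain ⟨y, hyq, hy⟩ := havoid
  refine ⟨{x, y}, Finset.card_le_two, le_antisymm ?_ ?_⟩
  · rw [hq.isRadical.radical_le_iff, Ideal.span_le]
    simp [Set.insert_subset_iff, hxq, hyq]
  rw [Ideal.radical_eq_sInf]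
  refine le_sInf fun J ⟨hJ, hJ'⟩ ↦ ?_
  have hxJ : x ∈ J := hJ (Ideal.subset_span (by simp))
  have hyJ : y ∈ J := hJ (Ideal.subset_span (by simp))
  obtain ⟨P, hP, hPJ⟩ := Ideal.exists_minimalPrimes_le ((Ideal.span_singleton_le_iff_mem J).2 hxJ)
  have : P.IsPrime := hP.1.1
  by_cases hyP : y ∈ P
  · rwa [← hy P (hS.2 hP) hyP]
  have hJm : J = IsLocalRing.maximalIdeal R := by
    by_contra hne
    refine hR.not_ge (three_le_ringKrullDim (q' := P) ?_
      (lt_of_le_of_ne hPJ fun h ↦ hyP (h ▸ hyJ)) hne)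
    rintro rfl
    exact hx (hP.1.2 (Ideal.mem_span_singleton_self x))
  rw [hJm]
  exact IsLocalRing.le_maximalIdeal hq.ne_top

end PrimesOfSmallDimension

theorem IsCountablyNoetherian.hasBoundedCountableFreeResolution_ideal {A : Type u} [CommRing A]
    (hA : IsCountablyNoetherian A) {I : Ideal A} {n : ℕ} (h : HasPdLT A I (n + 1)) :
    HasBoundedCountableFreeResolution A I :=
  hA.hasBoundedCountableFreeResolution
    (hA A ⟨{1}, Set.countable_singleton 1, Ideal.span_singleton_one⟩ I) h

/-! ### Projective ideals and the lower bound. -/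

section ProjectiveIdeal

theorem projective_of_globalDim_lt_two {A : Type u} [CommRing A] (h : globalDim A < 2)
    (I : Ideal A) : Module.Projective A I := by
  have h₂ : HasPdLT A (A ⧸ I) 2 :=
    CategoryTheory.projectiveDimension_lt_iff.1 ((le_iSup _ (ModuleCat.of A (A ⧸ I))).trans_lt h)
  exact hasPdLT_one_iff.1 (HasPdLT.left (Submodule.subtype_injective _) (Submodule.mkQ_surjective _)
    (LinearMap.exact_subtype_mkQ _) (.of_projective le_rfl) h₂)

/-- For a section `s` of the free cover, `x s(y) = y s(x)`. So every `s(y)` is supported on the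
finite support of `s(x)`, whose elements generate `P`. -/
theorem Ideal.fg_of_projective {A : Type*} [CommRing A] [IsDomain A] (P : Ideal A)
    [Module.Projective A P] : P.FG := by
  by_cases h₀ : P = ⊥
  · subst h₀
    exact Submodule.fg_bot
  obtain ⟨x, hxP, hx⟩ := Submodule.exists_mem_ne_zero_of_ne_bot h₀
  obtain ⟨s, hs⟩ := Module.projective_def'.1 ‹Module.Projective A P›
  let x' : P := ⟨x, hxP⟩
  refine ⟨(s x').support.map (Function.Embedding.subtype _),
    le_antisymm (Ideal.span_le.2 ?_) fun y hy ↦ ?_⟩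
  · simp +contextual [Set.subset_def]
  · have hsupp : (s ⟨y, hy⟩).support ⊆ (s x').support := by
      intro t ht
      rw [Finsupp.mem_support_iff] at ht ⊢
      have : x * s ⟨y, hy⟩ t = y * s x' t := by
        have : x • s ⟨y, hy⟩ = y • s x' := by
          rw [← map_smul, ← map_smul]
          congr 1
          exact Subtype.ext (mul_comm x y)
        simpa using DFunLike.congr_fun this t
      intro h0
      rw [h0, mul_zero] at this
      exact (mul_ne_zero hx ht) this
    have hy' : (Finsupp.linearCombination A id (s ⟨y, hy⟩) : P) = ⟨y, hy⟩ :=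
      LinearMap.congr_fun hs ⟨y, hy⟩
    have hy'' := congrArg (Submodule.subtype P) hy'
    rw [Finsupp.linearCombination_apply, map_finsuppSum] at hy''
    rw [show y = _ from hy''.symm]
    refine Ideal.sum_mem _ fun t ht ↦ ?_
    exact Ideal.mul_mem_left _ _ (Ideal.subset_span (Finset.mem_coe.2
      (Finset.mem_map_of_mem (Function.Embedding.subtype _) (hsupp ht))))

/-- Existence of `p`-th roots makes the maximal ideal idempotent, and projectivity makes it finitely
generated. -/
theorem maximalIdeal_eq_bot_of_projective {A : Type u} [CommRing A] [IsDomain A]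
    [IsLocalRing A] (p : ℕ) [Fact p.Prime] [CharP A p] [PerfectRing A p]
    [Module.Projective A (IsLocalRing.maximalIdeal A)] : IsLocalRing.maximalIdeal A = ⊥ := by
  have hfg := Ideal.fg_of_projective (IsLocalRing.maximalIdeal A)
  refine Submodule.eq_bot_of_le_smul_of_le_jacobson_bot (IsLocalRing.maximalIdeal A) _ hfg
    (fun a ha ↦ ?_) (IsLocalRing.maximalIdeal_le_jacobson ⊥)
  have hb : frobRoot p 1 a ∈ IsLocalRing.maximalIdeal A :=
    Ideal.IsPrime.mem_of_pow_mem inferInstance _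
      (by rwa [frobRoot_pow])
  rw [← frobRoot_pow p 1 a, pow_one]
  refine Ideal.pow_le_pow_right (Fact.out : p.Prime).two_le (Ideal.pow_mem_pow hb p) |> fun h ↦ ?_
  rwa [pow_two] at h

end ProjectiveIdeal

/-! ### Application to the perfect closure. -/

namespace PerfClosure

variable (R : Type u) [CommRing R] [IsDomain R] (p : ℕ) [Fact p.Prime] [CharP R p]

instance : IsDomain (PerfClosure R p) := inferInstanceAs (IsDomain (perfClosureSubalgebra R p))

theorem algebraMap_injective : Function.Injective (algebraMap R (PerfClosure R p)) := by
  have : FaithfulSMul R (AlgebraicClosure (FractionRing R)) :=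
    .trans R (FractionRing R) _
  intro a b h
  exact FaithfulSMul.algebraMap_injective R (AlgebraicClosure (FractionRing R))
    (congrArg (fun x : perfClosureSubalgebra R p ↦ (x : AbsIntegralClosure R).1) h)

instance : CharP (PerfClosure R p) p :=
  charP_of_injective_algebraMap (algebraMap_injective R p) p

theorem exists_algebraMap_eq_pow (a : PerfClosure R p) :
    ∃ n r, algebraMap R (PerfClosure R p) r = a ^ p ^ n := by
  obtain ⟨n, r, h⟩ := a.2
  exact ⟨n, r, Subtype.ext h⟩

instance : PerfectRing (PerfClosure R p) p := by
  refine ⟨frobenius_inj _ p, fun a ↦ ?_⟩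
  obtain ⟨n, r, h⟩ := a.2
  obtain ⟨y, hy⟩ := IsAlgClosed.exists_pow_nat_eq
    (a.1 : AlgebraicClosure (FractionRing R)) (Fact.out : p.Prime).pos
  have hint : IsIntegral R y := .of_pow (Fact.out : p.Prime).pos (hy ▸ a.1.2)
  exact ⟨⟨⟨y, hint⟩, n + 1, r, by
    rw [h, pow_succ', pow_mul]; congr 1; exact Subtype.ext hy.symm⟩, Subtype.ext (Subtype.ext hy)⟩

instance [IsLocalRing R] : IsLocalRing (PerfClosure R p) :=
  (isLocalRing_of_pow_mem p (algebraMap_injective R p) (exists_algebraMap_eq_pow R p)).1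

instance [IsLocalRing R] : IsLocalHom (algebraMap R (PerfClosure R p)) :=
  (isLocalRing_of_pow_mem p (algebraMap_injective R p) (exists_algebraMap_eq_pow R p)).2

section

variable {R p}

theorem exists_finset_card_le_radical_span_eq {P : Ideal (PerfClosure R p)} [hP : P.IsPrime]
    {s : Finset R}
    (hs : (Ideal.span (s : Set R)).radical = P.comap (algebraMap R (PerfClosure R p))) :
    ∃ t : Finset (PerfClosure R p), t.card ≤ s.card ∧
      (Ideal.span (t : Set (PerfClosure R p))).radical = P := by
  classical
  refine ⟨s.image (algebraMap R (PerfClosure R p)), Finset.card_image_le, ?_⟩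
  rw [Finset.coe_image, ← Ideal.map_span]
  exact hP.eq_radical_map p (exists_algebraMap_eq_pow R p) hs

theorem hasPdLT_of_radical_span_eq {P : Ideal (PerfClosure R p)} [P.IsPrime] {s : Finset R}
    (hs : (Ideal.span (s : Set R)).radical = P.comap (algebraMap R (PerfClosure R p))) :
    HasPdLT (PerfClosure R p) P (2 * s.card + 1) := by
  obtain ⟨t, ht, rfl⟩ := exists_finset_card_le_radical_span_eq hs
  exact (hasPdLT_radical_span p t).mono (by lia)

end

variable [IsNoetherianRing R]

theorem isCountablyNoetherian : IsCountablyNoetherian (PerfClosure R p) :=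
  isCountablyNoetherian_of_pow_mem p (exists_algebraMap_eq_pow R p)

theorem hasBoundedCountableFreeResolution (P : Ideal (PerfClosure R p)) [hP : P.IsPrime] :
    HasBoundedCountableFreeResolution (PerfClosure R p) P := by
  obtain ⟨s, hs⟩ := (isNoetherianRing_iff_ideal_fg R).1 ‹_›
    (P.comap (algebraMap R (PerfClosure R p)))
  have hs' : (Ideal.span (s : Set R)).radical = P.comap (algebraMap R (PerfClosure R p)) := by
    rw [hs]
    exact (hP.comap _).radical
  exact (isCountablyNoetherian R p).hasBoundedCountableFreeResolution_ideal
    (hasPdLT_of_radical_span_eq hs')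

theorem iSup_projDim_quotient_lt_top [IsLocalRing R] (hR : ringKrullDim R < 3) :
    (⨆ P : PrimeSpectrum (PerfClosure R p),
      projDim (PerfClosure R p) (PerfClosure R p ⧸ P.asIdeal)) < ⊤ := by
  obtain ⟨t, ht⟩ := IsNoetherian.noetherian (IsLocalRing.maximalIdeal R)
  have key (P : PrimeSpectrum (PerfClosure R p)) :
      HasPdLT (PerfClosure R p) (PerfClosure R p ⧸ P.asIdeal) (2 * (t.card + 2) + 2) := by
    -- A bound uniform in `P`: `t` serves the maximal ideal, and two elements serve any other prime.
    obtain ⟨s, hs, hs'⟩ : ∃ s : Finset R, s.card ≤ t.card + 2 ∧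
        (Ideal.span (s : Set R)).radical = P.asIdeal.comap (algebraMap R (PerfClosure R p)) := by
      by_cases hm : P.asIdeal.comap (algebraMap R (PerfClosure R p)) = IsLocalRing.maximalIdeal R
      · refine ⟨t, by lia, ?_⟩
        rw [hm, show Ideal.span (t : Set R) = _ from ht]
        exact Ideal.IsPrime.radical inferInstance
      · obtain ⟨s, hs, hs'⟩ := exists_finset_radical_span_eq hR hm
        exact ⟨s, by lia, hs'⟩
    exact ((hasPdLT_of_radical_span_eq hs').quotient _).mono (by lia)
  refine lt_of_le_of_lt (iSup_le fun P ↦ (CategoryTheory.projectiveDimension_lt_iff.2 (key P)).le) ?_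
  exact WithBot.coe_lt_coe.2 (ENat.natCast_lt_top _)

theorem globalDim_le [IsLocalRing R] (h : IsCoherentCommRing (PerfClosure R p)) :
    globalDim (PerfClosure R p) ≤ ringKrullDim R + 1 := by
  -- A system of parameters: `dim R` elements over which the maximal ideal is minimal, hence equal
  -- to their radical.
  obtain ⟨s, hs, hcard⟩ :=
    (IsLocalRing.maximalIdeal R).exists_finset_card_eq_height_of_isNoetherianRing
  have hrad : (Ideal.span (s : Set R)).radical =
      (IsLocalRing.maximalIdeal (PerfClosure R p)).comap (algebraMap R (PerfClosure R p)) := by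
    rw [IsLocalRing.maximalIdeal_comap]
    refine le_antisymm ?_ ?_
    · rw [hs.1.1.isRadical.radical_le_iff]
      exact hs.1.2
    · rw [Ideal.radical_eq_sInf]
      refine le_sInf fun J ⟨hJ, hJ'⟩ ↦ hs.2 ⟨hJ', hJ⟩ (IsLocalRing.le_maximalIdeal hJ'.ne_top)
  obtain ⟨t, ht, ht'⟩ := exists_finset_card_le_radical_span_eq hrad
  refine (globalDim_le_of_isCoherentCommRing p h (isCountablyNoetherian R p) t ht').trans ?_
  rw [← IsLocalRing.maximalIdeal_height_eq_ringKrullDim, ← hcard]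
  exact_mod_cast Nat.add_le_add_right ht 1

omit [IsNoetherianRing R] in
theorem isCoherentCommRing [IsRegularLocalRing R] : IsCoherentCommRing (PerfClosure R p) :=
  isCoherentCommRing_of_flat_iterateFrobenius p (algebraMap_injective R p)
    (exists_algebraMap_eq_pow R p) (IsRegularLocalRing.flat_iterateFrobenius R p)

omit [IsNoetherianRing R] in
theorem maximalIdeal_eq_bot_of_globalDim_lt_two [IsLocalRing R]
    (h : globalDim (PerfClosure R p) < 2) : IsLocalRing.maximalIdeal R = ⊥ := by
  have := projective_of_globalDim_lt_two h (IsLocalRing.maximalIdeal (PerfClosure R p))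
  rw [← IsLocalRing.maximalIdeal_comap (algebraMap R (PerfClosure R p)),
    maximalIdeal_eq_bot_of_projective p]
  exact Ideal.comap_bot_of_injective _ (algebraMap_injective R p)

omit [IsNoetherianRing R] in
theorem globalDim_eq_two [IsRegularLocalRing R] (hR : ringKrullDim R = 1) :
    globalDim (PerfClosure R p) = 2 := by
  refine le_antisymm ?_ (not_lt.1 fun h ↦ ?_)
  · have := globalDim_le R p (isCoherentCommRing R p)
    rwa [hR, one_add_one_eq_two] at this
  · have hF := IsLocalRing.isField_iff_maximalIdeal_eq.2
      (maximalIdeal_eq_bot_of_globalDim_lt_two R p h)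
    rw [ringKrullDim_eq_zero_of_isField hF] at hR
    exact zero_ne_one hR

end PerfClosure

theorem theorem1p2 (R : Type u) [CommRing R] [IsDomain R] [IsLocalRing R] [IsNoetherianRing R]
    (p : ℕ) [Fact p.Prime] [CharP R p] :
    (∀ P : Ideal (PerfClosure R p), P.IsPrime →
      HasBoundedCountableFreeResolution (PerfClosure R p) P) ∧
    (ringKrullDim R < 3 →
      (⨆ P : PrimeSpectrum (PerfClosure R p),
        projDim (PerfClosure R p) (PerfClosure R p ⧸ P.asIdeal)) < ⊤) ∧
    ((IsCoherentCommRing (PerfClosure R p) →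
        globalDim (PerfClosure R p) ≤ ringKrullDim R + 1) ∧
      (IsRegularLocalRing R → IsCoherentCommRing (PerfClosure R p))) ∧
    (IsRegularLocalRing R → ringKrullDim R = 1 → globalDim (PerfClosure R p) = 2) :=
  ⟨fun P _ ↦ PerfClosure.hasBoundedCountableFreeResolution R p P,
    PerfClosure.iSup_projDim_quotient_lt_top R p,
    ⟨PerfClosure.globalDim_le R p, fun _ ↦ PerfClosure.isCoherentCommRing R p⟩,
    fun _ ↦ PerfClosure.globalDim_eq_two R p⟩
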